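/- Let $p$ be a prime, let $S$ be an $\mathbb F_p$-scheme with absolute Frobenius $\operatorname{Fr}_S:S\to S$, and let $n\in\mathbb N$. For a group $S$-scheme $G$ and integers $0\le m\le n$ let $F^m:G\to(\operatorname{Fr}_S^m)^*G$ denote the ($m$-fold) relative Frobenius of $G$, and let $F^{n-m}:(\operatorname{Fr}_S^m)^*G\to(\operatorname{Fr}_S^n)^*G$ denote the relative Frobenius $F^{n-m}$ of $(\operatorname{Fr}_S^m)^*G$. A sequence of affine group $S$-schemes is called exact if the corresponding sequence of fpqc-sheaves of groups on the category of $S$-schemes is exact. A group $S$-scheme $G$ is called $n$-smooth if Zariski-locally on $S$ there exist an integer $r\ge 0$ and an isomorphism of pointed $S$-schemes $$G\simeq S\times_{\operatorname{Spec}\mathbb F_p}\operatorname{Spec} A_{n,r},\qquad A_{n,r}:=\mathbb F_p[x_1,\ldots,x_r]/(x_1^{p^n},\ldots,x_r^{p^n}),$$ where $G$ is pointed by its unit section and $\operatorname{Spec}A_{n,r}$ by the point $x_1=\dots=x_r=0$. Proposition. Let $G$ be a (not necessarily commutative) finite locally free group scheme over $S$ killed by $F^n$, i.e. such that $F^n:G\to(\operatorname{Fr}_S^n)^*G$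 is the trivial homomorphism. If the complex $$G\xrightarrow{F^m}(\operatorname{Fr}_S^m)^*G\xrightarrow{F^{n-m}}(\operatorname{Fr}_S^n)^*G$$ is exact for at least one $m\in\{1,\ldots,n-1\}$, then $G$ is $n$-smooth. -/

import Mathlib

open CategoryTheory Limits AlgebraicGeometry MonoidalCategory CartesianMonoidalCategory MonObj
open scoped Obj
open Opposite TopologicalSpace

universe u

namespace NSmooth

noncomputable section

/-! ### The absolute Frobenius -/

/-- The ring endomorphism `x ↦ x ^ (p ^ k)` of a commutative ring in which `p = 0`. -/
def ringFrob (p : ℕ) [Fact p.Prime] (k : ℕ) (R : Type u) [CommRing R] (hR : (p : R) = 0) :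
    R →+* R where
  toFun x := x ^ (p ^ k)
  map_one' := one_pow _
  map_mul' x y := mul_pow x y _
  map_zero' := zero_pow (pow_ne_zero k (Fact.out : p.Prime).ne_zero)
  map_add' x y := by
    obtain ⟨r, hr⟩ := exists_add_pow_prime_pow_eq (Fact.out : p.Prime) x y k
    rw [hr, hR]
    ring

lemma natCast_section (p : ℕ) (X : Scheme.{u}) (hX : (p : Γ(X, ⊤)) = 0) (U : X.Opens) :
    (p : Γ(X, U)) = 0 := by
  have h := congrArg (X.presheaf.map (homOfLE (le_top : U ≤ ⊤)).op).hom hX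
  simpa using h

/-- The morphism of presheafed spaces underlying the `k`-th power of the absolute Frobenius. -/
def absFrobPre (p : ℕ) [Fact p.Prime] (k : ℕ) (X : Scheme.{u}) (hX : (p : Γ(X, ⊤)) = 0) :
    X.toPresheafedSpace ⟶ X.toPresheafedSpace where
  base := 𝟙 _
  c :=
    { app := fun U => CommRingCat.ofHom
        (ringFrob p k Γ(X, U.unop) (natCast_section p X hX U.unop))
      naturality := fun U V f => by
        ext x
        exact map_pow (X.presheaf.map f).hom x (p ^ k) |>.symm }

/-- The `k`-th power `Fr^k : X ⟶ X` of the absolute Frobenius of a scheme `X` with `p = 0`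
in `𝒪_X`: the identity on the underlying space and `s ↦ s ^ (p ^ k)` on sections. -/
def absFrob (p : ℕ) [Fact p.Prime] (k : ℕ) (X : Scheme.{u}) (hX : (p : Γ(X, ⊤)) = 0) : X ⟶ X where
  toHom := absFrobPre p k X hX
  prop x := by
    refine ⟨fun a ha => ?_⟩
    obtain ⟨U, hx, s, rfl⟩ := TopCat.Presheaf.exists_germ_eq X.presheaf a
    have key : ((absFrobPre p k X hX).stalkMap x).hom (X.presheaf.germ U x hx s) =
        X.presheaf.germ U x hx s ^ (p ^ k) := by
      have h := congrArg (fun φ => φ.hom s)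
        (PresheafedSpace.stalkMap_germ (absFrobPre p k X hX) U x hx)
      exact h.trans (map_pow (X.presheaf.germ U x hx).hom s (p ^ k))
    have ha' : IsUnit (X.presheaf.germ U x hx s ^ (p ^ k)) := key ▸ ha
    exact (isUnit_pow_iff (pow_ne_zero k (Fact.out : p.Prime).ne_zero)).mp ha'

lemma natCast_of_hom {p : ℕ} {X Y : Scheme.{u}} (f : X ⟶ Y) (hY : (p : Γ(Y, ⊤)) = 0) :
    (p : Γ(X, ⊤)) = 0 := by
  have h := congrArg f.appTop.hom hY
  simpa using h

lemma absFrob_app (p : ℕ) [Fact p.Prime] (k : ℕ) (X : Scheme.{u}) (hX : (p : Γ(X, ⊤)) = 0)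
    (U : X.Opens) (s : Γ(X, U)) :
    ((absFrob p k X hX).app U).hom s = (s ^ (p ^ k) : Γ(X, U)) := rfl

lemma absFrob_naturality (p : ℕ) [Fact p.Prime] (k : ℕ) {X Y : Scheme.{u}} (f : X ⟶ Y)
    (hX : (p : Γ(X, ⊤)) = 0) (hY : (p : Γ(Y, ⊤)) = 0) :
    absFrob p k X hX ≫ f = f ≫ absFrob p k Y hY := by
  refine Scheme.Hom.ext (by rfl) fun U => ?_
  refine Eq.trans ?_ (Category.comp_id _)
  refine congrArg₂ (fun a b => a ≫ b) ?_ (X.presheaf.map_id _)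
  ext s
  exact (map_pow (f.app U).hom s (p ^ k)).symm

lemma absFrob_comp (p : ℕ) [Fact p.Prime] (k l : ℕ) (X : Scheme.{u}) (hX : (p : Γ(X, ⊤)) = 0) :
    absFrob p k X hX ≫ absFrob p l X hX = absFrob p (k + l) X hX := by
  refine Scheme.Hom.ext (by rfl) fun U => ?_
  refine Eq.trans ?_ (Category.comp_id _)
  refine congrArg₂ (fun a b => a ≫ b) ?_ (X.presheaf.map_id _)
  ext s
  refine Eq.trans (pow_mul s (p ^ l) (p ^ k)).symm ?_
  rw [← pow_add, add_comm]
  rfl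

/-! ### Frobenius twists and relative Frobenius -/

section Twist

variable (p : ℕ) [Fact p.Prime] {S : Scheme.{u}} (hS : (p : Γ(S, ⊤)) = 0)

/-- The base change `(Fr_S^k)^* X` of an `S`-scheme `X` along `Fr_S^k : S ⟶ S`. If `X` is a group
scheme then so is the base change, since the functor `Over.pullback` preserves finite products. -/
abbrev twist (k : ℕ) (X : Over S) : Over S := (Over.pullback (absFrob p k S hS)).obj X

/-- The projection `(Fr_S^k)^* X ⟶ X`, a morphism over `Fr_S^k : S ⟶ S`. -/
def twistProj (k : ℕ) (X : Over S) : (twist p hS k X).left ⟶ X.left :=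
  pullback.fst X.hom (absFrob p k S hS)

lemma twistProj_comp_hom (k : ℕ) (X : Over S) :
    twistProj p hS k X ≫ X.hom = (twist p hS k X).hom ≫ absFrob p k S hS :=
  pullback.condition

/-- The morphism of `S`-schemes `T ⟶ (Fr_S^k)^* X` given by a morphism `T ⟶ X` over `Fr_S^k`. -/
def twistLift (k : ℕ) {T X : Over S} (f : T.left ⟶ X.left)
    (hf : f ≫ X.hom = T.hom ≫ absFrob p k S hS) : T ⟶ twist p hS k X :=
  Over.homMk (pullback.lift f T.hom hf) (pullback.lift_snd _ _ _)

/-- The relative Frobenius `F^k : X ⟶ (Fr_S^k)^* X` of an `S`-scheme `X`: the morphism of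
`S`-schemes whose composite with the projection to `X` is `Fr_X^k`. -/
def relFrob (k : ℕ) (X : Over S) : X ⟶ twist p hS k X :=
  twistLift p hS k (absFrob p k X.left (natCast_of_hom X.hom hS))
    (absFrob_naturality p k X.hom _ hS)

/-- The canonical identification `(Fr_S^l)^* (Fr_S^k)^* X ⟶ (Fr_S^n)^* X`, where `k + l = n`. -/
def twistTwist (k l n : ℕ) (h : k + l = n) (X : Over S) :
    twist p hS l (twist p hS k X) ⟶ twist p hS n X :=
  twistLift p hS n (twistProj p hS l (twist p hS k X) ≫ twistProj p hS k X) (by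
    subst h
    rw [Category.assoc, twistProj_comp_hom, ← Category.assoc, twistProj_comp_hom, Category.assoc,
      absFrob_comp, add_comm l k])

/-- For `m ≤ n`, the morphism `F^(n-m) : (Fr_S^m)^* X ⟶ (Fr_S^n)^* X`, i.e. the relative
Frobenius `F^(n-m)` of `(Fr_S^m)^* X`. -/
def relFrobTwist {m n : ℕ} (h : m ≤ n) (X : Over S) : twist p hS m X ⟶ twist p hS n X :=
  relFrob p hS (n - m) (twist p hS m X) ≫
    twistTwist p hS m (n - m) n (Nat.add_sub_of_le h) X

/-- A group `S`-scheme `G` is killed by `F^n` if `F^n : G ⟶ (Fr_S^n)^* G` is trivial. -/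
def KilledByFrob (n : ℕ) (G : Over S) [GrpObj G] : Prop :=
  relFrob p hS n G = toUnit G ≫ η[twist p hS n G]

end Twist

/-! ### Exact sequences of group schemes -/

/-- Exactness of a sequence `G' ⟶ G ⟶ G''` of group `S`-schemes (with respect to homomorphisms
`f` and `h`) as a sequence of sheaves of groups for the fpqc topology on `S`-schemes: the
composite is trivial, and every `x ∈ G(T)` with trivial image in `G''(T)` comes from `G'`
locally on `T` for the fpqc topology. -/
structure FpqcExact {S : Scheme.{u}} {G' G G'' : Over S} [GrpObj G''] (f : G' ⟶ G) (h : G ⟶ G'') :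
    Prop where
  comp_trivial : f ≫ h = toUnit G' ≫ η[G'']
  locally_lifts : ∀ (T : Over S) (x : T ⟶ G), x ≫ h = toUnit T ≫ η[G''] →
    ∃ R ∈ Scheme.fpqcTopology.over S T, ∀ ⦃Y : Over S⦄ (g : Y ⟶ T), R g →
      ∃ y : Y ⟶ G', y ≫ f = g ≫ x

/-! ### `n`-smooth group schemes -/

/-- The field `𝔽_p`, in the universe `u`. -/
abbrev Fp (p : ℕ) : Type u := ULift.{u} (ZMod p)

lemma natCast_of_Fp {p : ℕ} {S : Scheme.{u}} (π : S ⟶ Spec (.of (Fp.{u} p))) :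
    (p : Γ(S, ⊤)) = 0 := by
  refine natCast_of_hom π ?_
  have h0 : (p : Fp.{u} p) = 0 := by
    apply ULift.down_injective
    simp
  have h := congrArg (Scheme.ΓSpecIso (.of (Fp.{u} p))).inv.hom h0
  rw [map_natCast, map_zero] at h
  exact h

/-- The ideal `(x_1^(p^n), …, x_r^(p^n))` of `𝔽_p[x_1, …, x_r]`. -/
def truncIdeal (p n r : ℕ) : Ideal (MvPolynomial (Fin r) (Fp.{u} p)) :=
  Ideal.span (Set.range fun i => MvPolynomial.X i ^ (p ^ n))

/-- The ring `A_{n,r} = 𝔽_p[x_1, …, x_r] / (x_1^(p^n), …, x_r^(p^n))`. -/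
abbrev TruncPoly (p n r : ℕ) : Type u :=
  MvPolynomial (Fin r) (Fp.{u} p) ⧸ truncIdeal.{u} p n r

/-- The augmentation `A_{n,r} →+* 𝔽_p`, `x_i ↦ 0`. -/
def truncAug (p : ℕ) [Fact p.Prime] (n r : ℕ) : TruncPoly.{u} p n r →+* Fp.{u} p :=
  Ideal.Quotient.lift (truncIdeal p n r) (MvPolynomial.aeval (fun _ => (0 : Fp.{u} p))).toRingHom
    (fun a ha => by
      have hle : truncIdeal p n r ≤
          RingHom.ker (MvPolynomial.aeval (R := Fp.{u} p) (fun _ : Fin r => (0 : Fp.{u} p))) := by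
        rw [truncIdeal, Ideal.span_le]
        rintro _ ⟨i, rfl⟩
        simp [RingHom.mem_ker, (Fact.out : p.Prime).ne_zero]
      exact hle ha)

/-- The structure morphism `Spec A_{n,r} ⟶ Spec 𝔽_p`. -/
def truncStr (p n r : ℕ) : Spec (.of (TruncPoly.{u} p n r)) ⟶ Spec (.of (Fp.{u} p)) :=
  Spec.map (CommRingCat.ofHom (algebraMap (Fp.{u} p) (TruncPoly.{u} p n r)))

/-- The point `Spec 𝔽_p ⟶ Spec A_{n,r}` given by `x_i ↦ 0`. -/
def truncPoint (p : ℕ) [Fact p.Prime] (n r : ℕ) :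
    Spec (.of (Fp.{u} p)) ⟶ Spec (.of (TruncPoly.{u} p n r)) :=
  Spec.map (CommRingCat.ofHom (truncAug p n r))

lemma truncPoint_comp_truncStr (p : ℕ) [Fact p.Prime] (n r : ℕ) :
    truncPoint.{u} p n r ≫ truncStr p n r = 𝟙 _ := by
  rw [truncPoint, truncStr, ← Spec.map_comp, ← CommRingCat.ofHom_comp]
  have : (truncAug.{u} p n r).comp (algebraMap (Fp.{u} p) (TruncPoly.{u} p n r)) =
      RingHom.id _ := by
    refine RingHom.ext fun a => ?_
    exact (MvPolynomial.aeval (R := Fp.{u} p) (fun _ : Fin r => (0 : Fp.{u} p))).commutes a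
  rw [this]
  exact Spec.map_id _

/-- The `U`-scheme `U × Spec A_{n,r}` (product over `Spec 𝔽_p`). -/
def truncOver (p n r : ℕ) {U : Scheme.{u}} (π : U ⟶ Spec (.of (Fp.{u} p))) : Over U :=
  Over.mk (pullback.fst π (truncStr p n r))

/-- The section of `U × Spec A_{n,r}` over `U` given by the point `x_i ↦ 0` of `Spec A_{n,r}`. -/
def truncSection (p : ℕ) [Fact p.Prime] (n r : ℕ) {U : Scheme.{u}}
    (π : U ⟶ Spec (.of (Fp.{u} p))) : 𝟙_ (Over U) ⟶ truncOver p n r π :=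
  Over.homMk (pullback.lift (𝟙 U) (π ≫ truncPoint p n r)
    (by
      rw [Category.assoc, truncPoint_comp_truncStr, Category.comp_id]
      exact Category.id_comp π))
    (pullback.lift_fst _ _ _)

/-- A group scheme `G` over an `𝔽_p`-scheme `S` is `n`-smooth if Zariski-locally on `S` there is
an isomorphism of pointed `S`-schemes `G ≅ S × Spec A_{n,r}` for some `r`; here `G` is
pointed by its unit section and `Spec A_{n,r}` by `x_i ↦ 0`. -/
def IsNSmooth (p : ℕ) [Fact p.Prime] {S : Scheme.{u}} (π : S ⟶ Spec (.of (Fp.{u} p))) (n : ℕ)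
    (G : Over S) [GrpObj G] : Prop :=
  ∀ s : S, ∃ U : S.Opens, s ∈ U ∧ ∃ (r : ℕ)
    (e : (Over.pullback U.ι).obj G ≅ truncOver p n r (U.ι ≫ π)),
    η[(Over.pullback U.ι).obj G] ≫ e.hom = truncSection p n r (U.ι ≫ π)

end

end NSmooth

/-! Over an affine open `Spec R` of `S` the group scheme is `Spec A` with `A` finite projective, and
a family of elements of `A` which is a basis over an algebraic closure of the residue field at a
prime of `R` is a basis over a neighbourhood of this prime. So it suffices to find elements `x_i` of
the augmentation ideal whose monomials with exponents less than `p ^ n` form a basis of `H` when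
`G = Spec H` over an algebraically closed field.

Let the `x_i` lift a basis of `I / I²`, where `I` is the augmentation ideal. Since `a ^ p ^ n = 0`
on `I`, the monomials span `H`. If the product `t` of the `x_i` satisfies `t ^ (p ^ n - 1) ≠ 0`,
they are linearly independent, because multiplication by the complementary monomial isolates a
minimal term of a linear relation. One shows that `t ^ (p ^ j - 1)` is not in `I^[p ^ j]`, the ideal
of the `j`-fold Frobenius kernel, by induction on `j ≤ n`. For `j = 1`, invariant vector fields dual
to the `x_i` lower `t ^ (p - 1)` to a unit. For `j = i + l` with `i ≤ m` and `m + l ≤ n`,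
`t ^ (p ^ j - 1) = (t ^ (p ^ l - 1)) ^ p ^ i * t ^ (p ^ i - 1)`.
If this is in `I^[p ^ j]`, translating by the `i`-fold Frobenius kernel cancels the second factor,
and exactness, applied to the test point `Spec (H / I^[p ^ l])`, shows that `t ^ (p ^ l - 1)` is in
`I^[p ^ l]`. -/

namespace NSmooth

noncomputable section

section BracketPower

variable {A B : Type*} [CommRing A] [CommRing B]

/-- The bracket power `I^[q]`, the ideal generated by the `q`-th powers of the elements of `I`. If
`I` is the augmentation ideal of a group scheme in characteristic `p`, then `I^[p ^ j]` is the ideal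
of the kernel of the `j`-fold Frobenius. -/
def bracketPower (I : Ideal A) (q : ℕ) : Ideal A :=
  Ideal.span ((· ^ q) '' (I : Set A))

lemma pow_mem_bracketPower {I : Ideal A} {a : A} (ha : a ∈ I) (q : ℕ) :
    a ^ q ∈ bracketPower I q :=
  Ideal.subset_span ⟨a, ha, rfl⟩

lemma bracketPower_le_iff {I J : Ideal A} {q : ℕ} :
    bracketPower I q ≤ J ↔ ∀ a ∈ I, a ^ q ∈ J := by
  rw [bracketPower, Ideal.span_le]
  exact Set.image_subset_iff

lemma bracketPower_le_self (I : Ideal A) {q : ℕ} (hq : q ≠ 0) : bracketPower I q ≤ I :=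
  bracketPower_le_iff.2 fun _ ha => I.pow_mem_of_mem ha q hq.pos

@[simp] lemma bracketPower_one (I : Ideal A) : bracketPower I 1 = I := by
  simp [bracketPower]

lemma bracketPower_le_of_dvd (I : Ideal A) {q q' : ℕ} (h : q ∣ q') (hq' : q' ≠ 0) :
    bracketPower I q' ≤ bracketPower I q := by
  obtain ⟨c, rfl⟩ := h
  refine bracketPower_le_iff.2 fun a ha => ?_
  rw [pow_mul]
  exact Ideal.pow_mem_of_mem _ (pow_mem_bracketPower ha q) c (right_ne_zero_of_mul hq').pos

lemma bracketPower_map (p : ℕ) [ExpChar B p] {F : Type*} [FunLike F A B] [RingHomClass F A B]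
    (f : F) (I : Ideal A) (j : ℕ) :
    bracketPower (I.map f) (p ^ j) = (bracketPower I (p ^ j)).map f := by
  calc bracketPower (I.map f) (p ^ j) =
        (I.map (f : A →+* B)).map (iterateFrobenius B p j) := rfl
    _ = Ideal.span ((f · ^ p ^ j) '' (I : Set A)) := Ideal.map_map _ _
    _ = (bracketPower I (p ^ j)).map f := by
      simp only [bracketPower, Ideal.map_span, Set.image_image, map_pow]

lemma bracketPower_bracketPower (p : ℕ) [ExpChar A p] (I : Ideal A) (i j : ℕ) :
    bracketPower (bracketPower I (p ^ i)) (p ^ j) = bracketPower I (p ^ (i + j)) := by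
  have h (J : Ideal A) (l : ℕ) : bracketPower J (p ^ l) = J.map (iterateFrobenius A p l) := rfl
  rw [h I, bracketPower_map, h I, Ideal.map_map, h I, add_comm]
  congr 1
  ext a
  simp only [RingHom.comp_apply, iterateFrobenius_def, ← pow_mul, pow_add]

end BracketPower

section Slice

open scoped TensorProduct

variable {k H Q : Type*} [CommRing k] [CommRing H] [Algebra k H] [AddCommGroup Q] [Module k Q]

/-- The `H`-linear map `id ⊗ φ : H ⊗ Q → H` given by a linear functional `φ` on `Q`. -/
def slice (φ : Q →ₗ[k] k) : H ⊗[k] Q →ₗ[H] H :=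
  (TensorProduct.AlgebraTensorModule.rid k H H).toLinearMap ∘ₗ φ.baseChange H

@[simp] lemma slice_tmul (φ : Q →ₗ[k] k) (a : H) (q : Q) : slice φ (a ⊗ₜ[k] q) = φ q • a := by
  simp [slice]

lemma apply_mem_of_mem_map_algebraMap {R S : Type*} [CommRing R] [CommRing S] [Algebra R S]
    (f : S →ₗ[R] R) {J : Ideal R} {t : S} (ht : t ∈ J.map (algebraMap R S)) : f t ∈ J := by
  rw [← Submodule.restrictScalars_mem R, ← Ideal.smul_top_eq_map] at ht
  refine Submodule.smul_induction_on ht (fun a ha s _ => ?_) fun s t hs ht => ?_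
  · rw [map_smul]
    exact Ideal.mul_mem_right _ _ ha
  · rw [map_add]
    exact add_mem hs ht

end Slice

section Bialgebra

open scoped TensorProduct

section CommRing

variable (k : Type*) {H : Type*} [CommRing k] [CommRing H] [Bialgebra k H]

variable (H) in
/-- The kernel of the counit, that is, the ideal of the unit section. -/
abbrev augmentationIdeal : Ideal H := RingHom.ker (Bialgebra.counitAlgHom k H)

lemma comul_sub_tmul_one_mem (a : H) :
    Bialgebra.comulAlgHom k H a - a ⊗ₜ 1 ∈
      (augmentationIdeal k H).map (Algebra.TensorProduct.includeRight : H →ₐ[k] H ⊗[k] H) := by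
  have hsurj : Function.Surjective (Bialgebra.counitAlgHom k H) := fun r =>
    ⟨algebraMap k H r, by simp⟩
  rw [augmentationIdeal, ← Algebra.TensorProduct.lTensor_ker _ hsurj, RingHom.mem_ker, map_sub,
    sub_eq_zero]
  have h : Algebra.TensorProduct.map (.id k H) (Bialgebra.counitAlgHom k H)
      (Bialgebra.comulAlgHom k H a) = a ⊗ₜ 1 := Coalgebra.lTensor_counit_comul (R := k) a
  rw [h]
  simp

/-- The action of the closed subscheme `Spec (H ⧸ J)` on `Spec H` by right translation. -/
def quotientCoaction (J : Ideal H) : H →ₐ[k] H ⊗[k] (H ⧸ J) :=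
  (Algebra.TensorProduct.map (.id k H) (Ideal.Quotient.mkₐ k J)).comp (Bialgebra.comulAlgHom k H)

lemma quotientCoaction_sub_algebraMap_mem (J : Ideal H) (a : H) :
    quotientCoaction k J a - algebraMap H _ a ∈ (augmentationIdeal k H).map
      ((Algebra.TensorProduct.includeRight : H ⧸ J →ₐ[k] H ⊗[k] (H ⧸ J)).comp
        (Ideal.Quotient.mkₐ k J)) := by
  have := Ideal.mem_map_of_mem
    (Algebra.TensorProduct.map (.id k H) (Ideal.Quotient.mkₐ k J)) (comul_sub_tmul_one_mem k a)
  rw [Ideal.map_mapₐ, Algebra.TensorProduct.map_comp_includeRight] at this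
  simpa [quotientCoaction] using this

lemma map_includeRight_comp_mk_eq_bot {I J : Ideal H} (h : I ≤ J) :
    I.map ((Algebra.TensorProduct.includeRight : H ⧸ J →ₐ[k] H ⊗[k] (H ⧸ J)).comp
      (Ideal.Quotient.mkₐ k J)) = ⊥ := by
  rw [eq_bot_iff, Ideal.map_le_iff_le_comap]
  intro a ha
  simp [Ideal.Quotient.eq_zero_iff_mem.2 (h ha)]

lemma counit_slice_quotientCoaction {J : Ideal H} (φ : H ⧸ J →ₗ[k] k) (a : H) :
    Coalgebra.counit (R := k) (slice φ (quotientCoaction k J a)) = φ (Ideal.Quotient.mk J a) := by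
  have key (t : H ⊗[k] H) : Coalgebra.counit (R := k)
      (slice φ (Algebra.TensorProduct.map (.id k H) (Ideal.Quotient.mkₐ k J) t)) =
      φ (Ideal.Quotient.mkₐ k J (TensorProduct.lid k H (Coalgebra.counit.rTensor H t))) := by
    induction t with
    | zero => simp
    | add s t hs ht => simp only [map_add, hs, ht]
    | tmul a b => simp [-Ideal.Quotient.mkₐ_eq_mk, mul_comm]
  refine (key (Coalgebra.comul a)).trans ?_
  simp

lemma quotientCoaction_sq_mul (a b : H) :
    quotientCoaction k (augmentationIdeal k H ^ 2) (a * b) =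
      a • quotientCoaction k (augmentationIdeal k H ^ 2) b +
        b • quotientCoaction k (augmentationIdeal k H ^ 2) a - algebraMap H _ (a * b) := by
  have h := Ideal.mul_mem_mul
    (quotientCoaction_sub_algebraMap_mem k (augmentationIdeal k H ^ 2) a)
    (quotientCoaction_sub_algebraMap_mem k (augmentationIdeal k H ^ 2) b)
  rw [← Ideal.map_mul, ← pow_two, map_includeRight_comp_mk_eq_bot k le_rfl, Ideal.mem_bot] at h
  have smul_eq (a : H) (t : H ⊗[k] (H ⧸ augmentationIdeal k H ^ 2)) :
      a • t = algebraMap H _ a * t := Algebra.smul_def a t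
  rw [map_mul, map_mul, ← sub_eq_zero, ← h, smul_eq, smul_eq]
  ring

/-- The left-invariant vector field on `Spec H` whose value at the unit section is the tangent
vector given by `φ`. -/
def invariantDerivation (φ : H ⧸ augmentationIdeal k H ^ 2 →ₗ[k] k) : Derivation k H H :=
  Derivation.mk' ((slice φ).restrictScalars k ∘ₗ
    (quotientCoaction k (augmentationIdeal k H ^ 2)).toLinearMap - φ 1 • LinearMap.id) fun a b => by
    have h : slice φ (algebraMap H (H ⊗[k] (H ⧸ augmentationIdeal k H ^ 2)) (a * b)) =
        φ 1 • (a * b) := by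
      rw [Algebra.TensorProduct.algebraMap_apply, slice_tmul, Algebra.algebraMap_self_apply]
    simp only [LinearMap.sub_apply, LinearMap.comp_apply, AlgHom.toLinearMap_apply,
      LinearMap.restrictScalars_apply, LinearMap.smul_apply, LinearMap.id_apply,
      quotientCoaction_sq_mul, map_add, map_sub, map_smul, h, smul_eq_mul]
    simp only [Algebra.smul_def]
    ring

lemma counit_invariantDerivation (φ : H ⧸ augmentationIdeal k H ^ 2 →ₗ[k] k) {a : H}
    (ha : a ∈ augmentationIdeal k H) :
    Coalgebra.counit (R := k) (invariantDerivation k φ a) = φ (Ideal.Quotient.mk _ a) := by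
  have ha' : Coalgebra.counit (R := k) a = 0 := ha
  simp [invariantDerivation, counit_slice_quotientCoaction, ha']

end CommRing

section Field

variable {k H : Type*} [Field k] [CommRing H] [Bialgebra k H]

lemma exists_derivation_sub_mem {σ : Type*} [DecidableEq σ] {x : σ → H}
    (hx : ∀ i, x i ∈ augmentationIdeal k H)
    (hli : LinearIndependent k fun i => Ideal.Quotient.mk (augmentationIdeal k H ^ 2) (x i))
    (i : σ) :
    ∃ D : Derivation k H H, ∀ j, D (x j) - (Pi.single i 1 : σ → H) j ∈ augmentationIdeal k H := by
  obtain ⟨f, hf⟩ := LinearMap.exists_leftInverse_of_injective _ (LinearMap.ker_eq_bot.2 hli)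
  have hfx (j : σ) : f (Ideal.Quotient.mk _ (x j)) = Finsupp.single j 1 := by
    simpa using LinearMap.congr_fun hf (Finsupp.single j 1)
  refine ⟨invariantDerivation k (Finsupp.lapply i ∘ₗ f), fun j => ?_⟩
  rw [RingHom.mem_ker, map_sub, sub_eq_zero]
  refine (counit_invariantDerivation k _ (hx j)).trans ?_
  obtain rfl | hij := eq_or_ne j i
  · simp [hfx]
  · simp [hfx, hij]

variable (p : ℕ) [ExpChar k p]

variable (k H) in
include k in
lemma expChar_of_bialgebra : ExpChar H p :=
  have : Nontrivial H := (Bialgebra.counitAlgHom k H).toRingHom.domain_nontrivial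
  expChar_of_injective_algebraMap (algebraMap k H).injective p

lemma quotientCoaction_pow {J : Ideal H} {N : ℕ}
    (hJ : bracketPower (augmentationIdeal k H) (p ^ N) ≤ J) (a : H) :
    quotientCoaction k J (a ^ p ^ N) = algebraMap H _ (a ^ p ^ N) := by
  obtain hJ' | hJ' := subsingleton_or_nontrivial (H ⊗[k] (H ⧸ J))
  · exact Subsingleton.elim _ _
  have : ExpChar (H ⊗[k] (H ⧸ J)) p :=
    expChar_of_injective_algebraMap (algebraMap k (H ⊗[k] (H ⧸ J))).injective p
  have h := pow_mem_bracketPower (quotientCoaction_sub_algebraMap_mem k J a) (p ^ N)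
  rw [bracketPower_map, map_includeRight_comp_mk_eq_bot k hJ] at h
  rwa [Ideal.mem_bot, sub_pow_expChar_pow, sub_eq_zero, ← map_pow, ← map_pow] at h

/-- The idea is to restrict the function `a ^ p ^ j * y` to translates of the `j`-th Frobenius
kernel, along which `a ^ p ^ j` is constant while `y` is not zero. -/
lemma pow_mem_bracketPower_of_pow_mul_mem (hI : ∀ a ∈ augmentationIdeal k H, IsNilpotent a)
    {j N : ℕ} (hjN : j ≤ N) {a y : H} (hy : y ∉ bracketPower (augmentationIdeal k H) (p ^ j))
    (hay : a ^ p ^ j * y ∈ bracketPower (augmentationIdeal k H) (p ^ N)) :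
    a ^ p ^ j ∈ bracketPower (augmentationIdeal k H) (p ^ N) := by
  set J := bracketPower (augmentationIdeal k H) (p ^ j)
  have hNJ : bracketPower (augmentationIdeal k H) (p ^ N) ≤ J :=
    bracketPower_le_of_dvd _ (pow_dvd_pow p hjN) (pow_ne_zero _ (expChar_ne_zero k p))
  obtain ⟨φ, hφ⟩ := Module.Projective.exists_dual_eq_one k
    (mt Ideal.Quotient.eq_zero_iff_mem.1 hy : Ideal.Quotient.mk J y ≠ 0)
  have hunit : IsUnit (slice φ (quotientCoaction k J y)) := by
    have h : slice φ (quotientCoaction k J y) - 1 ∈ augmentationIdeal k H := by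
      rw [RingHom.mem_ker, map_sub, map_one, sub_eq_zero]
      exact (counit_slice_quotientCoaction k φ y).trans hφ
    simpa using (hI _ h).isUnit_one_add
  have hmap : (bracketPower (augmentationIdeal k H) (p ^ N)) ≤
      ((bracketPower (augmentationIdeal k H) (p ^ N)).map
        (algebraMap H (H ⊗[k] (H ⧸ J)))).comap (quotientCoaction k J) := by
    refine bracketPower_le_iff.2 fun b hb => ?_
    rw [Ideal.mem_comap, quotientCoaction_pow p hNJ]
    exact Ideal.mem_map_of_mem _ (pow_mem_bracketPower hb _)
  have hslice := apply_mem_of_mem_map_algebraMap (slice φ) (hmap hay)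
  rw [map_mul, quotientCoaction_pow p le_rfl, ← Algebra.smul_def, map_smul, smul_eq_mul] at hslice
  exact (Ideal.mul_unit_mem_iff_mem _ hunit).1 hslice

end Field

end Bialgebra

section Derivation

variable {k A : Type*} [CommRing k] [CommRing A] [Algebra k A] (D : Derivation k A A) {I : Ideal A}

lemma derivation_mem_pow {d : ℕ} {a : A} (ha : a ∈ I ^ (d + 1)) : D a ∈ I ^ d := by
  induction d generalizing a with
  | zero => simp
  | succ d ih =>
    rw [pow_succ] at ha
    refine Submodule.mul_induction_on ha (fun b hb c hc => ?_) fun b c hb hc => ?_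
    · rw [D.leibniz, smul_eq_mul, smul_eq_mul, pow_succ]
      refine add_mem (Ideal.mul_mem_right _ _ (pow_succ I d ▸ hb)) ?_
      rw [mul_comm c]
      exact Ideal.mul_mem_mul (ih hb) hc
    · rw [map_add]
      exact add_mem hb hc

lemma derivation_mem_bracketPower (p : ℕ) [CharP A p] {a : A} (ha : a ∈ bracketPower I p) :
    D a ∈ bracketPower I p := by
  refine Submodule.span_induction ?_ (by simp) (fun b c _ _ hb hc => ?_) (fun c b hb' hb => ?_) ha
  · rintro _ ⟨b, -, rfl⟩
    simp [D.leibniz_pow]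
  · rw [map_add]
    exact add_mem hb hc
  · rw [smul_eq_mul, D.leibniz]
    exact add_mem (Ideal.mul_mem_left _ _ hb) (Ideal.mul_mem_right _ _ hb')

variable {σ : Type*} {x : σ → A} (hx : ∀ i, x i ∈ I)
include hx

lemma prod_pow_mem_pow_sum (s : Finset σ) (α : σ → ℕ) :
    ∏ j ∈ s, x j ^ α j ∈ I ^ ∑ j ∈ s, α j := by
  rw [← Finset.prod_pow_eq_pow_sum]
  exact Ideal.prod_mem_prod fun j _ => Ideal.pow_mem_pow (hx j) _

lemma derivation_prod_pow_mem (s : Finset σ) (α : σ → ℕ) (hD : ∀ j ∈ s, D (x j) ∈ I) :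
    D (∏ j ∈ s, x j ^ α j) ∈ I ^ ∑ j ∈ s, α j := by
  classical
  induction s using Finset.induction_on with
  | empty => simp
  | insert j s hj ih =>
    have hpow : D (x j ^ α j) ∈ I ^ α j := by
      rw [D.leibniz_pow]
      obtain h | ⟨a, h⟩ : α j = 0 ∨ ∃ a, α j = a + 1 := by cases α j <;> simp
      · simp [h]
      · rw [h, pow_succ, Nat.add_sub_cancel]
        exact Submodule.smul_of_tower_mem _ _
          (Ideal.mul_mem_mul (Ideal.pow_mem_pow (hx j) a) (hD j (Finset.mem_insert_self j s)))
    rw [Finset.prod_insert hj, Finset.sum_insert hj, D.leibniz, pow_add, smul_eq_mul, smul_eq_mul,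
      mul_comm (∏ j ∈ s, _)]
    exact add_mem
      (Ideal.mul_mem_mul (Ideal.pow_mem_pow (hx j) _)
        (ih fun j' hj' => hD j' (Finset.mem_insert_of_mem hj')))
      (Ideal.mul_mem_mul hpow (prod_pow_mem_pow_sum hx s α))

lemma derivation_prod_pow_sub_mem [Fintype σ] [DecidableEq σ] {i : σ}
    (hD : ∀ j, D (x j) - (Pi.single i 1 : σ → A) j ∈ I) (α : σ → ℕ) :
    D (∏ j, x j ^ (α + Pi.single i 1 : σ → ℕ) j) - (α i + 1 : ℕ) * ∏ j, x j ^ α j ∈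
      I ^ (∑ j, α j + 1) := by
  set P := ∏ j ∈ Finset.univ.erase i, x j ^ α j
  have hP : ∏ j, x j ^ (α + Pi.single i 1 : σ → ℕ) j = x i ^ (α i + 1) * P := by
    rw [← Finset.mul_prod_erase _ _ (Finset.mem_univ i)]
    congr 1
    · simp
    · exact Finset.prod_congr rfl fun j hj => by simp [Finset.ne_of_mem_erase hj]
  have hDP : D P ∈ I ^ ∑ j ∈ Finset.univ.erase i, α j :=
    derivation_prod_pow_mem D hx _ α fun j hj => by simpa [Finset.ne_of_mem_erase hj] using hD j
  have hDx : D (x i) - 1 ∈ I := by simpa using hD i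
  have key : D (x i ^ (α i + 1) * P) - (α i + 1 : ℕ) * (x i ^ α i * P) =
      x i ^ (α i + 1) * D P + (α i + 1 : ℕ) * (x i ^ α i * (D (x i) - 1) * P) := by
    simp only [D.leibniz, D.leibniz_pow, nsmul_eq_mul, smul_eq_mul, add_tsub_cancel_right]
    ring
  rw [hP, ← Finset.mul_prod_erase _ _ (Finset.mem_univ i), key,
    ← Finset.add_sum_erase _ _ (Finset.mem_univ i), add_right_comm, pow_add, pow_succ]
  refine add_mem ?_ (Ideal.mul_mem_left _ _ ?_)
  · rw [← pow_succ]
    exact Ideal.mul_mem_mul (Ideal.pow_mem_pow (hx i) _) hDP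
  · exact Ideal.mul_mem_mul (Ideal.mul_mem_mul (Ideal.pow_mem_pow (hx i) _) hDx)
      (prod_pow_mem_pow_sum hx _ α)

/-- The vector fields dual to the coordinates lower the degree of a leading monomial without
killing it as long as its exponents are smaller than `p`. -/
lemma prod_pow_notMem_bracketPower_sup_pow [Fintype σ] [DecidableEq σ] (p : ℕ) [Fact p.Prime]
    [CharP A p] (hI : I ≠ ⊤)
    (hD : ∀ i, ∃ D : Derivation k A A, ∀ j, D (x j) - (Pi.single i 1 : σ → A) j ∈ I)
    (d : ℕ) (α : σ → ℕ) (hα : ∀ i, α i < p) (hd : ∑ i, α i = d) :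
    ∏ i, x i ^ α i ∉ bracketPower I p ⊔ I ^ (d + 1) := by
  have hp : p.Prime := Fact.out
  induction d generalizing α with
  | zero =>
    have hα0 : α = 0 := by simpa [funext_iff] using hd
    have hle : bracketPower I p ⊔ I ^ (0 + 1) ≤ I := by
      simpa using bracketPower_le_self I hp.ne_zero
    intro h
    exact hI ((Ideal.eq_top_iff_one I).2 (by simpa [hα0] using hle h))
  | succ d ih =>
    obtain ⟨i, hi⟩ : ∃ i, α i ≠ 0 := by
      by_contra! h
      simp [h] at hd
    obtain ⟨β, rfl⟩ : ∃ β : σ → ℕ, α = β + Pi.single i 1 := by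
      refine ⟨α - Pi.single i 1, (tsub_add_cancel_of_le fun j => ?_).symm⟩
      obtain rfl | hj := eq_or_ne j i
      · simpa using Nat.one_le_iff_ne_zero.2 hi
      · simp [hj]
    have hβd : ∑ j, β j = d := by simpa [Finset.sum_add_distrib] using hd
    have hβi : β i + 1 < p := by simpa using hα i
    obtain ⟨D, hD⟩ := hD i
    intro hmem
    have hDmem : D (∏ j, x j ^ (β + Pi.single i 1 : σ → ℕ) j) ∈ bracketPower I p ⊔ I ^ (d + 1) := by
      obtain ⟨a, ha, b, hb, hab⟩ := Submodule.mem_sup.1 hmem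
      rw [← hab, map_add]
      exact Submodule.add_mem_sup (derivation_mem_bracketPower D p ha) (derivation_mem_pow D hb)
    have hlead := Ideal.mem_sup_right (S := bracketPower I p)
      (hβd ▸ derivation_prod_pow_sub_mem D hx hD β)
    have hunit : IsUnit ((β i + 1 : ℕ) : A) :=
      (CharP.isUnit_natCast_iff hp).2 (Nat.not_dvd_of_pos_of_lt (Nat.succ_pos _) hβi)
    refine ih β (fun j => (hα j).trans_le' (by simp)) hβd
      ((Ideal.unit_mul_mem_iff_mem _ hunit).1 ?_)
    simpa using sub_mem hDmem hlead

end Derivation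

section FrobeniusFiltration

variable {k H : Type*} [Field k] [CommRing H] [Bialgebra k H] (p : ℕ) [ExpChar k p]

variable (k H) in
/-- Injectivity of the ring homomorphisms dual to `F ^ m`, regarded as a map from the kernel of
`F ^ (m + l)` to the kernel of `F ^ l` on the `m`-fold Frobenius twist, for all `m + l ≤ n`. -/
def FrobeniusReflects (m n : ℕ) : Prop :=
  ∀ l, m + l ≤ n → ∀ b : H, b ^ p ^ m ∈ bracketPower (augmentationIdeal k H) (p ^ (m + l)) →
    b ∈ bracketPower (augmentationIdeal k H) (p ^ l)

variable {p} {m n : ℕ} (hfrob : FrobeniusReflects k H p m n)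
include hfrob

lemma FrobeniusReflects.of_le {i l : ℕ} (hi : i ≤ m) (hl : m + l ≤ n) {b : H}
    (hb : b ^ p ^ i ∈ bracketPower (augmentationIdeal k H) (p ^ (i + l))) :
    b ∈ bracketPower (augmentationIdeal k H) (p ^ l) := by
  have : ExpChar H p := expChar_of_bialgebra k H p
  have h := pow_mem_bracketPower hb (p ^ (m - i))
  rw [bracketPower_bracketPower, ← pow_mul, ← pow_add, add_right_comm, Nat.add_sub_cancel' hi] at h
  exact hfrob l hl b h

lemma FrobeniusReflects.pow_notMem_bracketPower (hm : 1 ≤ m) (hmn : m < n)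
    (hI : ∀ a ∈ augmentationIdeal k H, IsNilpotent a) {t : H}
    (ht : t ^ (p - 1) ∉ bracketPower (augmentationIdeal k H) p) {j : ℕ} (hj : j ≤ n) :
    t ^ (p ^ j - 1) ∉ bracketPower (augmentationIdeal k H) (p ^ j) := by
  induction j using Nat.strong_induction_on with | _ j ih
  obtain rfl | rfl | hj2 : j = 0 ∨ j = 1 ∨ 2 ≤ j := by omega
  · simp [RingHom.mem_ker]
  · simpa using ht
  obtain ⟨i, l, rfl, hi, hl, him, hlm⟩ : ∃ i l, j = i + l ∧ 1 ≤ i ∧ 1 ≤ l ∧ i ≤ m ∧ m + l ≤ n := by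
    obtain h | h := le_or_gt j m
    · exact ⟨j - 1, 1, by omega⟩
    · exact ⟨m, j - m, by omega⟩
  intro h
  refine ih l (by omega) (by omega) (hfrob.of_le him hlm ?_)
  refine pow_mem_bracketPower_of_pow_mul_mem p hI (Nat.le_add_right i l)
    (ih i (by omega) (by omega)) ?_
  have hexp : (p ^ l - 1) * p ^ i + (p ^ i - 1) = p ^ (i + l) - 1 := by
    have h1 := Nat.one_le_pow i p (expChar_pos k p)
    have h2 := Nat.le_mul_of_pos_left (p ^ i) (Nat.pow_pos (n := l) (expChar_pos k p))
    rw [Nat.sub_mul, pow_add, mul_comm (p ^ i)]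
    omega
  rwa [← pow_mul, ← pow_add, hexp]

end FrobeniusFiltration

section TruncatedMonomials

variable {A B σ : Type*} [CommRing A] [CommRing B] [Fintype σ] {N : ℕ} {x : σ → A}

/-- The monomials in the `x i` with all exponents smaller than `N`. -/
def truncMonomial (x : σ → A) (α : σ → Fin N) : A := ∏ i, x i ^ (α i : ℕ)

lemma map_truncMonomial {F : Type*} [FunLike F A B] [RingHomClass F A B] (f : F) (x : σ → A)
    (α : σ → Fin N) : f (truncMonomial x α) = truncMonomial (f ∘ x) α := by
  simp [truncMonomial]

lemma truncMonomial_mul_rev (x : σ → A) (α : σ → Fin N) :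
    truncMonomial x α * truncMonomial x (Fin.rev ∘ α) = (∏ i, x i) ^ (N - 1) := by
  rw [truncMonomial, truncMonomial, ← Finset.prod_mul_distrib, ← Finset.prod_pow]
  refine Finset.prod_congr rfl fun i _ => ?_
  rw [← pow_add, Function.comp_apply, Fin.val_rev]
  congr 1
  omega

lemma truncMonomial_mul_rev_eq_zero (hx : ∀ i, x i ^ N = 0) {α β : σ → Fin N} (h : ¬ β ≤ α) :
    truncMonomial x β * truncMonomial x (Fin.rev ∘ α) = 0 := by
  obtain ⟨i, hi⟩ : ∃ i, α i < β i := by simpa [Pi.le_def] using h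
  rw [truncMonomial, truncMonomial, ← Finset.prod_mul_distrib]
  refine Finset.prod_eq_zero (Finset.mem_univ i) ?_
  rw [← pow_add, Function.comp_apply, Fin.val_rev]
  exact pow_eq_zero_of_le (by have := Fin.lt_def.1 hi; omega) (hx i)

lemma linearIndependent_truncMonomial {k : Type*} [Field k] [Algebra k A]
    (hx : ∀ i, x i ^ N = 0) (htop : (∏ i, x i) ^ (N - 1) ≠ 0) :
    LinearIndependent k (truncMonomial (N := N) x) := by
  classical
  rw [Fintype.linearIndependent_iff]
  intro c hc
  by_contra! hne
  obtain ⟨α, hα, hmin⟩ := (Set.toFinite {α | c α ≠ 0}).exists_minimal hne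
  refine hα ((smul_eq_zero_iff_left htop).1 ?_)
  calc c α • (∏ i, x i) ^ (N - 1)
      = ∑ β, c β • truncMonomial x β * truncMonomial x (Fin.rev ∘ α) := by
        rw [Finset.sum_eq_single α, smul_mul_assoc, truncMonomial_mul_rev]
        · intro β _ hβ
          by_cases h0 : c β = 0
          · simp [h0]
          · rw [smul_mul_assoc, truncMonomial_mul_rev_eq_zero hx, smul_zero]
            exact fun hle => hβ (hle.antisymm (hmin h0 hle))
        · simp
    _ = 0 := by rw [← Finset.sum_mul, hc, zero_mul]

lemma span_truncMonomial_eq_top {R : Type*} [CommRing R] [Algebra R A]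
    (hadjoin : Algebra.adjoin R (Set.range x) = ⊤) (hx : ∀ i, x i ^ N = 0) :
    Submodule.span R (Set.range (truncMonomial (N := N) x)) = ⊤ := by
  rw [eq_top_iff]
  intro a _
  obtain ⟨f, rfl⟩ : a ∈ (MvPolynomial.aeval (R := R) x).range := by
    rw [← Algebra.adjoin_range_eq_range_aeval, hadjoin]
    trivial
  simp only [AlgHom.toRingHom_eq_coe, RingHom.coe_coe]
  induction f using MvPolynomial.induction_on' with
  | add f g hf hg =>
    rw [map_add]
    exact add_mem (hf trivial) (hg trivial)
  | monomial α c =>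
    rw [MvPolynomial.aeval_monomial, ← Algebra.smul_def, Finsupp.prod_fintype _ _ (by simp)]
    refine Submodule.smul_mem _ _ ?_
    by_cases h : ∀ i, α i < N
    · exact Submodule.subset_span ⟨fun i => ⟨α i, h i⟩, rfl⟩
    · obtain ⟨i, hi⟩ := not_forall.1 h
      have h0 : x i ^ α i = 0 := pow_eq_zero_of_le (not_lt.1 hi) (hx i)
      rw [Finset.prod_eq_zero (Finset.mem_univ i) h0]
      exact zero_mem _

end TruncatedMonomials

lemma adjoin_eq_top_of_span_eq {R A σ : Type*} [CommRing R] [CommRing A] [Algebra R A] {I : Ideal A}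
    (hnil : IsNilpotent I) (hI : ∀ a, ∃ c : R, a - algebraMap R A c ∈ I) {x : σ → A}
    (hx : Ideal.span (Set.range x) = I) : Algebra.adjoin R (Set.range x) = ⊤ := by
  set S := Algebra.adjoin R (Set.range x)
  have approx (d : ℕ) (a : A) : ∃ s ∈ S, a - s ∈ I ^ d := by
    induction d generalizing a with
    | zero => exact ⟨0, zero_mem _, by simp⟩
    | succ d ih =>
      obtain ⟨c, hc⟩ := hI a
      have hc' : a - algebraMap R A c ∈ Ideal.span (Set.range x) := hx ▸ hc
      obtain ⟨b, hb⟩ := (Finsupp.mem_ideal_span_range_iff_exists_finsupp).1 hc'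
      choose s hs hbs using fun i => ih (b i)
      refine ⟨algebraMap R A c + b.sum fun i _ => s i * x i, add_mem (S.algebraMap_mem c)
        (sum_mem fun i _ => mul_mem (hs i) (Algebra.subset_adjoin ⟨i, rfl⟩)), ?_⟩
      rw [← sub_sub, ← hb, Finsupp.sum, Finsupp.sum, ← Finset.sum_sub_distrib]
      refine sum_mem fun i _ => ?_
      rw [← sub_mul, pow_succ]
      exact Ideal.mul_mem_mul (hbs i) (hx ▸ Ideal.subset_span ⟨i, rfl⟩)
  obtain ⟨d, hd⟩ := hnil
  rw [eq_top_iff]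
  intro a _
  obtain ⟨s, hs, has⟩ := approx d a
  rw [hd, Ideal.zero_eq_bot, Ideal.mem_bot, sub_eq_zero] at has
  exact has ▸ hs

section Coordinates

variable {k H : Type*} [Field k] [CommRing H] [Bialgebra k H]

lemma exists_coordinates [Module.Finite k H] (hI : ∀ a ∈ augmentationIdeal k H, IsNilpotent a)
    {s : Set H} (hs : Ideal.span s = augmentationIdeal k H) :
    ∃ (r : ℕ) (x : Fin r → H), (∀ i, x i ∈ s) ∧
      Ideal.span (Set.range x) = augmentationIdeal k H ∧
      LinearIndependent k fun i => Ideal.Quotient.mk (augmentationIdeal k H ^ 2) (x i) := by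
  have : IsNoetherianRing H := .of_finite k H
  let q := (Ideal.Quotient.mkₐ k (augmentationIdeal k H ^ 2)).toLinearMap
  obtain ⟨κ, c, -, hspan, hli⟩ := exists_linearIndependent' k fun a : s => q a
  have : Finite κ := hli.finite
  obtain ⟨r, ⟨e⟩⟩ := Finite.exists_equiv_fin κ
  let x : Fin r → H := fun i => c (e.symm i)
  have hxs (i) : x i ∈ s := (c (e.symm i)).2
  have hxspan : Submodule.span k (Set.range (q ∘ x)) = Submodule.span k (q '' s) := by
    rw [Set.image_eq_range, ← hspan, ← e.symm.surjective.range_comp]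
    rfl
  refine ⟨r, x, hxs, le_antisymm ?_ ?_, hli.comp _ e.symm.injective⟩
  · exact hs ▸ Ideal.span_mono (Set.range_subset_iff.2 hxs)
  refine Submodule.le_of_le_smul_of_le_jacobson_bot (IsNoetherian.noetherian _)
    (fun a ha => Ideal.radical_le_jacobson (hI a ha)) ?_
  rw [smul_eq_mul, ← pow_two]
  nth_rewrite 1 [← hs]
  refine Ideal.span_le.2 fun a ha => ?_
  obtain ⟨b, hb, hba⟩ : q a ∈ (Submodule.span k (Set.range x)).map q := by
    rw [Submodule.map_span, ← Set.range_comp, hxspan]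
    exact Submodule.subset_span ⟨a, ha, rfl⟩
  have hab : a - b ∈ augmentationIdeal k H ^ 2 := Ideal.Quotient.eq.1 hba.symm
  rw [← add_sub_cancel b a]
  exact Submodule.add_mem_sup (Submodule.span_le_restrictScalars k H _ hb) hab

variable {p m n : ℕ} [Fact p.Prime] [CharP k p] {σ : Type*} [Fintype σ] {x : σ → H}

lemma prod_pow_pred_notMem_bracketPower (hx : ∀ i, x i ∈ augmentationIdeal k H)
    (hli : LinearIndependent k fun i => Ideal.Quotient.mk (augmentationIdeal k H ^ 2) (x i)) :
    (∏ i, x i) ^ (p - 1) ∉ bracketPower (augmentationIdeal k H) p := by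
  classical
  have : Nontrivial H := (Bialgebra.counitAlgHom k H).toRingHom.domain_nontrivial
  have : CharP H p := charP_of_injective_algebraMap (algebraMap k H).injective p
  rw [← Finset.prod_pow]
  exact fun h => prod_pow_notMem_bracketPower_sup_pow (k := k) hx p (RingHom.ker_ne_top _)
    (exists_derivation_sub_mem hx hli) _ (fun _ => p - 1)
    (fun _ => Nat.sub_lt (Fact.out : p.Prime).pos one_pos) rfl (Ideal.mem_sup_left h)

lemma FrobeniusReflects.exists_basis_truncMonomial [Module.Finite k H]
    (hfrob : FrobeniusReflects k H p m n) (hm : 1 ≤ m) (hmn : m < n)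
    (hkill : ∀ a ∈ augmentationIdeal k H, a ^ p ^ n = 0)
    (hx : Ideal.span (Set.range x) = augmentationIdeal k H)
    (hli : LinearIndependent k fun i => Ideal.Quotient.mk (augmentationIdeal k H ^ 2) (x i)) :
    ∃ b : Module.Basis (σ → Fin (p ^ n)) k H, ∀ α, b α = truncMonomial x α := by
  have : ExpChar k p := .prime Fact.out
  have : IsNoetherianRing H := .of_finite k H
  have hxI (i : σ) : x i ∈ augmentationIdeal k H := hx ▸ Ideal.subset_span ⟨i, rfl⟩
  have hnil : ∀ a ∈ augmentationIdeal k H, IsNilpotent a := fun a ha => ⟨_, hkill a ha⟩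
  have hnil' : IsNilpotent (augmentationIdeal k H) :=
    (Ideal.FG.isNilpotent_iff_le_nilradical (IsNoetherian.noetherian _)).2 hnil
  have hxn (i : σ) : x i ^ p ^ n = 0 := hkill _ (hxI i)
  have hbasis : LinearIndependent k (truncMonomial (N := p ^ n) x) := by
    refine linearIndependent_truncMonomial hxn fun h => ?_
    exact hfrob.pow_notMem_bracketPower hm hmn hnil
      (prod_pow_pred_notMem_bracketPower hxI hli) le_rfl (h ▸ zero_mem _)
  have hspan : Submodule.span k (Set.range (truncMonomial (N := p ^ n) x)) = ⊤ := by
    refine span_truncMonomial_eq_top (adjoin_eq_top_of_span_eq hnil' (fun a => ?_) hx) hxn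
    exact ⟨Coalgebra.counit a, by simp [RingHom.mem_ker]⟩
  exact ⟨.mk hbasis hspan.ge, fun α => Module.Basis.mk_apply _ _ α⟩

end Coordinates

section Spreading

open scoped TensorProduct

variable {R M J : Type*} [CommRing R] [AddCommGroup M] [Module R M]

lemma isLocalizedModule_map_linearCombination (S : Submonoid R) (R' : Type*) [CommRing R']
    [Algebra R R'] [IsLocalization S R'] {M' : Type*} [AddCommGroup M'] [Module R M']
    [Module R' M'] [IsScalarTower R R' M'] (g : M →ₗ[R] M') [IsLocalizedModule S g] (v : J → M) :
    IsLocalizedModule.map S (Finsupp.mapRange.linearMap (α := J) (Algebra.linearMap R R')) g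
      (Finsupp.linearCombination R v) =
      (Finsupp.linearCombination R' (g ∘ v)).restrictScalars R := by
  refine IsLocalizedModule.linearMap_ext S
    (Finsupp.mapRange.linearMap (α := J) (Algebra.linearMap R R')) g ?_
  rw [IsLocalizedModule.map_comp]
  ext i
  simp

lemma exists_basis_eq_iff_bijective {v : J → M} :
    (∃ b : Module.Basis J R M, ∀ i, b i = v i) ↔
      Function.Bijective (Finsupp.linearCombination R v) := by
  constructor
  · rintro ⟨b, hb⟩
    obtain rfl : ⇑b = v := funext hb
    refine ⟨b.linearIndependent, LinearMap.range_eq_top.1 ?_⟩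
    rw [Finsupp.range_linearCombination, b.span_eq]
  · rintro ⟨hli, hsurj⟩
    have hspan := LinearMap.range_eq_top.2 hsurj
    rw [Finsupp.range_linearCombination] at hspan
    exact ⟨.mk hli hspan.ge, Module.Basis.mk_apply hli hspan.ge⟩

lemma exists_basis_of_basis_fieldExtension {k K V : Type*} [Field k] [Field K] [Algebra k K]
    [AddCommGroup V] [Module k V] [Finite J] {v : J → V}
    (hv : ∃ b : Module.Basis J K (K ⊗[k] V), ∀ i, b i = 1 ⊗ₜ v i) :
    ∃ b : Module.Basis J k V, ∀ i, b i = v i := by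
  have := Fintype.ofFinite J
  obtain ⟨b, hb⟩ := hv
  have := Module.Finite.of_basis b
  have : Module.Finite k V := .of_finite_tensorProduct_of_faithfullyFlat K
  have hli : LinearIndependent k v := by
    refine .of_comp (TensorProduct.mk k K V 1) ?_
    have h := b.linearIndependent.restrict_scalars' k
    rwa [funext hb] at h
  have hspan : Submodule.span k (Set.range v) = ⊤ := by
    refine hli.span_eq_top_of_card_eq_finrank' ?_
    rw [← Module.finrank_eq_card_basis b, Module.finrank_baseChange]
  exact ⟨.mk hli hspan.ge, Module.Basis.mk_apply hli hspan.ge⟩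

lemma exists_basis_baseChange_of_isScalarTower {R' R'' : Type*} [CommRing R'] [CommRing R'']
    [Algebra R R'] [Algebra R R''] [Algebra R' R''] [IsScalarTower R R' R''] {v : J → M}
    (hv : ∃ b : Module.Basis J R'' (R'' ⊗[R] M), ∀ i, b i = 1 ⊗ₜ v i) :
    ∃ b : Module.Basis J R'' (R'' ⊗[R'] (R' ⊗[R] M)), ∀ i, b i = 1 ⊗ₜ (1 ⊗ₜ v i) := by
  obtain ⟨b, hb⟩ := hv
  refine ⟨b.map (TensorProduct.AlgebraTensorModule.cancelBaseChange R R' R'' R'' M).symm,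
    fun i => ?_⟩
  simp [hb]

lemma exists_basis_localizationAtPrime [Module.FinitePresentation R M] [Module.Flat R M] [Finite J]
    {v : J → M} (P : Ideal R) [P.IsPrime] {K : Type*} [Field K] [Algebra R K]
    [Algebra P.ResidueField K] [IsScalarTower R P.ResidueField K]
    (hv : ∃ b : Module.Basis J K (K ⊗[R] M), ∀ i, b i = 1 ⊗ₜ v i) :
    ∃ b : Module.Basis J (Localization.AtPrime P) (Localization.AtPrime P ⊗[R] M),
      ∀ i, b i = 1 ⊗ₜ v i := by
  obtain ⟨b, hb⟩ := exists_basis_baseChange_of_isScalarTower (R' := Localization.AtPrime P)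
    (exists_basis_of_basis_fieldExtension
      (exists_basis_baseChange_of_isScalarTower (R' := P.ResidueField) hv))
  have hb' : TensorProduct.mk (Localization.AtPrime P) P.ResidueField _ 1 ∘
      (fun i => 1 ⊗ₜ v i) = b := (funext hb).symm
  exact Module.exists_basis_of_basis_baseChange _ (hb' ▸ b.linearIndependent) (hb' ▸ b.span_eq)
    (Module.Flat.rTensor_preserves_injective_linearMap _ Subtype.val_injective)

lemma exists_notMem_forall_basis_baseChange [Module.FinitePresentation R M] [Module.Flat R M]
    [Finite J] {v : J → M} (P : Ideal R) [P.IsPrime] {K : Type*} [Field K] [Algebra R K]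
    [Algebra P.ResidueField K] [IsScalarTower R P.ResidueField K]
    (hv : ∃ b : Module.Basis J K (K ⊗[R] M), ∀ i, b i = 1 ⊗ₜ v i) :
    ∃ f ∉ P, ∀ (R' : Type*) [CommRing R'] [Algebra R R'] [IsLocalization.Away f R'],
      ∃ b : Module.Basis J R' (R' ⊗[R] M), ∀ i, b i = 1 ⊗ₜ v i := by
  have hP := exists_basis_eq_iff_bijective.1 (exists_basis_localizationAtPrime P hv)
  obtain ⟨f, hfP, hf⟩ := Module.FinitePresentation.exists_notMem_bijective
    (Finsupp.linearCombination R v) P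
    (Finsupp.mapRange.linearMap (α := J) (Algebra.linearMap R (Localization.AtPrime P)))
    (TensorProduct.mk R (Localization.AtPrime P) M 1) (by
      rw [isLocalizedModule_map_linearCombination P.primeCompl (Localization.AtPrime P)]
      exact hP)
  refine ⟨f, hfP, fun R' _ _ _ => exists_basis_eq_iff_bijective.2 ?_⟩
  rwa [← IsLocalizedModule.map_bijective_iff_localizedModuleMap_bijective
    (Finsupp.mapRange.linearMap (α := J) (Algebra.linearMap R R')) (TensorProduct.mk R R' M 1),
    isLocalizedModule_map_linearCombination _ R'] at hf

end Spreading

section GroupChart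

open scoped TensorProduct

lemma unit_pullback_fst {S T : Scheme.{u}} (f : T ⟶ S) (G : Over S) [GrpObj G] :
    η[(Over.pullback f).obj G].left ≫ pullback.fst G.hom f = f ≫ η[G].left := by
  have hη : η[(Over.pullback f).obj G] = Functor.LaxMonoidal.ε (Over.pullback f) ≫
    (Over.pullback f).map η[G] := rfl
  have hmap : ((Over.pullback f).map η[G]).left ≫ pullback.fst G.hom f =
      pullback.fst _ _ ≫ η[G].left := pullback.lift_fst _ _ _
  rw [hη, Over.comp_left, Category.assoc, hmap, Over.ε_pullback_left, ← Category.assoc]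
  congr 1
  rw [IsIso.inv_comp_eq]
  simpa only [Category.comp_id] using! pullback.condition (f := 𝟙 S) (g := f)

variable {S : Scheme.{u}} {R A : Type u} [CommRing R] [CommRing A] [Bialgebra R A]

/-- The bialgebra `A` represents the pullback of the group scheme `G` along the `R`-valued point
`iU` of `S`. Of the group structure, only the compatibility with the unit section is recorded. -/
structure IsGroupChart (G : Over S) [GrpObj G] (iU : Spec (.of R) ⟶ S)
    (iV : Spec (.of A) ⟶ G.left) : Prop where
  isPullback : IsPullback iV (Spec.map (CommRingCat.ofHom (algebraMap R A))) G.hom iU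
  unit : Spec.map (CommRingCat.ofHom (Bialgebra.counitAlgHom R A).toRingHom) ≫ iV =
    iU ≫ η[G].left

lemma exists_isGroupChart (G : Over S) [GrpObj G] [IsAffineHom G.hom] (iU : Spec (.of R) ⟶ S) :
    ∃ (A : Type u) (_ : CommRing A) (_ : Bialgebra R A) (iV : Spec (.of A) ⟶ G.left),
      IsGroupChart G iU iV := by
  have hG : IsAffine ((Over.pullback iU).obj G).left :=
    inferInstanceAs (IsAffine (pullback G.hom iU))
  obtain ⟨⟨A⟩, ⟨e⟩⟩ := (essImage_bialgSpec (G := .mk ((Over.pullback iU).obj G))).mpr hG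
  let i : Spec (.of A) ≅ pullback G.hom iU := (Over.forget _).mapIso ((Mon.forget _).mapIso e)
  have hsnd : i.hom ≫ pullback.snd G.hom iU = Spec.map (CommRingCat.ofHom (algebraMap R A)) :=
    Over.w e.hom.hom
  have hunit : Spec.map (CommRingCat.ofHom (Bialgebra.counitAlgHom R A).toRingHom) ≫ i.hom =
      η[(Over.pullback iU).obj G].left := congrArg (·.left) (IsMonHom.one_hom e.hom.hom)
  refine ⟨A, inferInstance, inferInstance, i.hom ≫ pullback.fst G.hom iU, ?_, ?_⟩
  · exact (IsPullback.of_hasPullback G.hom iU).of_iso i.symm (.refl _) (.refl _) (.refl _)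
      (by simp) (by simp [← hsnd]) (by simp) (by simp)
  · rw [← Category.assoc, hunit, unit_pullback_fst]

variable {G : Over S} [GrpObj G] {iU : Spec (.of R) ⟶ S} {iV : Spec (.of A) ⟶ G.left}

lemma IsGroupChart.baseChange (h : IsGroupChart G iU iV) (R' : Type u) [CommRing R']
    [Algebra R R'] :
    IsGroupChart G (Spec.map (CommRingCat.ofHom (algebraMap R R')) ≫ iU)
      (Spec.map (CommRingCat.ofHom (Algebra.TensorProduct.includeRight
        (R := R) (A := R') (B := A)).toRingHom) ≫ iV) where
  isPullback := ((isPullback_SpecMap_of_isPushout _ _ _ _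
    (CommRingCat.isPushout_tensorProduct R R' A)).flip).paste_horiz h.isPullback
  unit := by
    have hcounit : CommRingCat.ofHom (Algebra.TensorProduct.includeRight
        (R := R) (A := R') (B := A)).toRingHom ≫
          CommRingCat.ofHom (Bialgebra.counitAlgHom R' (R' ⊗[R] A)).toRingHom =
        CommRingCat.ofHom (Bialgebra.counitAlgHom R A).toRingHom ≫
          CommRingCat.ofHom (algebraMap R R') := by
      ext a
      simp [Algebra.smul_def]
    rw [← Spec.map_comp_assoc, hcounit, Spec.map_comp_assoc, h.unit, Category.assoc]

lemma IsGroupChart.module_flat (h : IsGroupChart G iU iV) [Flat G.hom] : Module.Flat R A := by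
  have := MorphismProperty.of_isPullback (P := @Flat) h.isPullback ‹_›
  rwa [Flat.SpecMap_iff, CommRingCat.hom_ofHom, RingHom.flat_algebraMap_iff] at this

lemma IsGroupChart.module_finitePresentation (h : IsGroupChart G iU iV) [IsFinite G.hom]
    [LocallyOfFinitePresentation G.hom] : Module.FinitePresentation R A := by
  have hfin := MorphismProperty.of_isPullback (P := @IsFinite) h.isPullback ‹_›
  rw [IsFinite.SpecMap_iff, CommRingCat.hom_ofHom, RingHom.finite_algebraMap] at hfin
  have hfp :=
    MorphismProperty.of_isPullback (P := @LocallyOfFinitePresentation) h.isPullback ‹_›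
  rw [HasRingHomProperty.Spec_iff (P := @LocallyOfFinitePresentation), CommRingCat.hom_ofHom,
    RingHom.finitePresentation_algebraMap] at hfp
  exact Module.FinitePresentation.of_finite_of_finitePresentation R A

end GroupChart

section Frobenius

variable (p : ℕ)

lemma natCast_eq_zero_of_Spec {S : Scheme.{u}} (hS : (p : Γ(S, ⊤)) = 0) {R : CommRingCat.{u}}
    (iU : Spec R ⟶ S) : (p : R) = 0 := by
  have h := congrArg (Scheme.ΓSpecIso R).hom.hom (natCast_of_hom iU hS)
  rwa [map_natCast, map_zero] at h

variable [Fact p.Prime]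

lemma absFrob_Spec (k : ℕ) (B : CommRingCat.{u}) (h : (p : Γ(Spec B, ⊤)) = 0) (hB : (p : B) = 0) :
    absFrob p k (Spec B) h = Spec.map (CommRingCat.ofHom (ringFrob p k B hB)) := by
  refine ext_to_Spec ?_
  ext b
  have hnat := congrArg (fun f => f.hom b)
    (Scheme.ΓSpecIso_inv_naturality (CommRingCat.ofHom (ringFrob p k B hB)))
  exact (map_pow (Scheme.ΓSpecIso B).inv.hom b (p ^ k)).symm.trans hnat

variable {S : Scheme.{u}} (hS : (p : Γ(S, ⊤)) = 0)

lemma twist_hom_ext (k : ℕ) {T X : Over S} {f g : T ⟶ twist p hS k X}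
    (h : f.left ≫ twistProj p hS k X = g.left ≫ twistProj p hS k X) : f = g := by
  ext1
  exact pullback.hom_ext h ((Over.w f).trans (Over.w g).symm)

lemma twistLift_proj (k : ℕ) {T X : Over S} (f : T.left ⟶ X.left)
    (hf : f ≫ X.hom = T.hom ≫ absFrob p k S hS) :
    (twistLift p hS k f hf).left ≫ twistProj p hS k X = f :=
  pullback.lift_fst _ _ _

lemma relFrob_proj (k : ℕ) (X : Over S) :
    (relFrob p hS k X).left ≫ twistProj p hS k X =
      absFrob p k X.left (natCast_of_hom X.hom hS) :=
  twistLift_proj _ _ _ _ _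

lemma relFrobTwist_proj {m n : ℕ} (h : m ≤ n) (X : Over S) :
    (relFrobTwist p hS h X).left ≫ twistProj p hS n X =
      absFrob p (n - m) (twist p hS m X).left (natCast_of_hom (twist p hS m X).hom hS) ≫
        twistProj p hS m X := by
  rw [relFrobTwist, Over.comp_left, Category.assoc, twistTwist, twistLift_proj, ← Category.assoc,
    relFrob_proj]

lemma trivial_twist_proj (k : ℕ) {T G : Over S} [GrpObj G] :
    (toUnit T ≫ η[twist p hS k G]).left ≫ twistProj p hS k G =
      absFrob p k T.left (natCast_of_hom T.hom hS) ≫ T.hom ≫ η[G].left := by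
  rw [← Category.assoc, absFrob_naturality p k T.hom _ hS, Category.assoc, Over.comp_left,
    Category.assoc, ← unit_pullback_fst]
  rfl

end Frobenius

section GroupChartFrobenius

variable {p : ℕ} [Fact p.Prime] {S : Scheme.{u}} {hS : (p : Γ(S, ⊤)) = 0} {G : Over S} [GrpObj G]
  {R A : Type u} [CommRing R] [CommRing A] [Bialgebra R A] {iU : Spec (.of R) ⟶ S}
  {iV : Spec (.of A) ⟶ G.left}

lemma IsGroupChart.pow_eq_zero_of_killedByFrob (H : IsGroupChart G iU iV) {n : ℕ}
    (hkilled : KilledByFrob p hS n G) {a : A} (ha : a ∈ augmentationIdeal R A) :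
    a ^ p ^ n = 0 := by
  have hVS : (p : Γ(Spec (.of A), ⊤)) = 0 := natCast_of_hom (iV ≫ G.hom) hS
  have hA : (p : A) = 0 := natCast_eq_zero_of_Spec p hS (R := .of A) (iV ≫ G.hom)
  let F := CommRingCat.ofHom (ringFrob p n A hA)
  let e := CommRingCat.ofHom (Bialgebra.counitAlgHom R A).toRingHom
  let i := CommRingCat.ofHom (algebraMap R A)
  have hie : i ≫ e = 𝟙 _ := by
    ext r
    exact (Bialgebra.counitAlgHom R A).commutes r
  have hfrob : absFrob p n G.left (natCast_of_hom G.hom hS) =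
      absFrob p n G.left (natCast_of_hom G.hom hS) ≫ G.hom ≫ η[G].left := by
    rw [← trivial_twist_proj, ← relFrob_proj, hkilled]
  have hF : Spec.map F ≫ iV = iV ≫ absFrob p n G.left (natCast_of_hom G.hom hS) := by
    rw [← absFrob_Spec p n (.of A) hVS hA, absFrob_naturality]
  have hspec : F = e ≫ i ≫ F := by
    refine Spec.map_injective (H.isPullback.hom_ext ?_ ?_)
    · calc Spec.map F ≫ iV
          = (Spec.map F ≫ iV) ≫ G.hom ≫ η[G].left := by
            rw [hF, Category.assoc, ← hfrob]
        _ = Spec.map F ≫ Spec.map i ≫ iU ≫ η[G].left := by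
            rw [Category.assoc, reassoc_of% H.isPullback.w]
        _ = Spec.map (e ≫ i ≫ F) ≫ iV := by
            rw [← H.unit, Spec.map_comp, Spec.map_comp, Category.assoc, Category.assoc]
    · rw [← Spec.map_comp, ← Spec.map_comp]
      exact congrArg Spec.map (by rw [reassoc_of% hie])
  calc a ^ p ^ n = (e ≫ i ≫ F).hom a := congrArg (fun f => f.hom a) hspec
    _ = (i ≫ F).hom 0 := congrArg (i ≫ F).hom ha
    _ = 0 := map_zero _

end GroupChartFrobenius

section FpqcLocal

variable {B : CommRingCat.{u}} {W : Sieve (Spec B)}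

lemma eq_of_mem_fpqcTopology (hW : W ∈ Scheme.fpqcTopology (Spec B)) {C : CommRingCat.{u}}
    {u v : C ⟶ B} (h : ∀ (D : CommRingCat.{u}) (g : B ⟶ D), W (Spec.map g) → u ≫ g = v ≫ g) :
    u = v := by
  have hsep := (GrothendieckTopology.Subcanonical.isSheaf_of_isRepresentable
    (J := Scheme.fpqcTopology) (yoneda.obj (Spec C))).isSeparated
  refine Spec.map_injective ((hsep W hW).ext fun Z g hg => ?_)
  change g ≫ Spec.map u = g ≫ Spec.map v
  refine Scheme.Cover.hom_ext Z.affineCover _ _ fun i => ?_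
  have hi : W (Spec.map (Spec.preimage (Z.affineCover.f i ≫ g))) := by
    rw [Spec.map_preimage]
    exact W.downward_closed hg _
  have hcomp := congrArg Spec.map (h _ _ hi)
  rw [Spec.map_comp, Spec.map_comp, Spec.map_preimage] at hcomp
  exact (Category.assoc _ _ _).symm.trans (hcomp.trans (Category.assoc _ _ _))

lemma eq_zero_of_mem_fpqcTopology (hW : W ∈ Scheme.fpqcTopology (Spec B)) {b : B}
    (h : ∀ (D : CommRingCat.{u}) (g : B ⟶ D), W (Spec.map g) → g.hom b = 0) : b = 0 := by
  let ev (c : B) : CommRingCat.of (Polynomial B) ⟶ B :=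
    CommRingCat.ofHom (Polynomial.evalRingHom c)
  have hev : ev b = ev 0 := by
    refine eq_of_mem_fpqcTopology hW fun D g hg => ?_
    ext
    · simp [ev]
    · simp [ev, h D g hg]
  simpa [ev] using congrArg (fun f => f.hom Polynomial.X) hev

end FpqcLocal

section TwistPoint

variable {p : ℕ} [Fact p.Prime] {S : Scheme.{u}} {G : Over S} [GrpObj G] {R A B : Type u}
  [CommRing R] [CommRing A] [CommRing B] [Bialgebra R A] {iU : Spec (.of R) ⟶ S}
  {iV : Spec (.of A) ⟶ G.left} {m n : ℕ} (H : IsGroupChart G iU iV) (hS : (p : Γ(S, ⊤)) = 0)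
  (hB : (p : B) = 0) {θ : R →+* B} {φ : A →+* B}
  (hφ : φ.comp (algebraMap R A) = (ringFrob p m B hB).comp θ)

include H hφ in
lemma IsGroupChart.comp_hom_eq_comp_absFrob :
    (Spec.map (CommRingCat.ofHom φ) ≫ iV) ≫ G.hom =
      (Spec.map (CommRingCat.ofHom θ) ≫ iU) ≫ absFrob p m S hS := by
  have hTS := natCast_of_hom (Spec.map (CommRingCat.ofHom θ) ≫ iU) hS
  rw [← absFrob_naturality p m _ hTS hS, absFrob_Spec p m (.of B) hTS hB, Category.assoc,
    H.isPullback.w, ← Spec.map_comp_assoc, ← Spec.map_comp_assoc, ← CommRingCat.ofHom_comp,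
    ← CommRingCat.ofHom_comp, hφ]

/-- Over a chart of `G`, the `B`-valued point of the twist `(Fr^m)^* G` given by a homomorphism
`φ : A →+* B` that is semilinear along the `m`-th power of the Frobenius. -/
def IsGroupChart.twistPoint :
    Over.mk (Spec.map (CommRingCat.ofHom θ) ≫ iU) ⟶ twist p hS m G :=
  twistLift p hS m (Spec.map (CommRingCat.ofHom φ) ≫ iV) (H.comp_hom_eq_comp_absFrob hS hB hφ)

lemma IsGroupChart.twistPoint_proj :
    (H.twistPoint hS hB hφ).left ≫ twistProj p hS m G = Spec.map (CommRingCat.ofHom φ) ≫ iV :=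
  twistLift_proj _ _ _ _ _

lemma IsGroupChart.twistPoint_relFrobTwist (hmn : m ≤ n)
    (hφn : ∀ a ∈ augmentationIdeal R A, φ a ^ p ^ (n - m) = 0) :
    H.twistPoint hS hB hφ ≫ relFrobTwist p hS hmn G = toUnit _ ≫ η[twist p hS n G] := by
  let T := Over.mk (Spec.map (CommRingCat.ofHom θ) ≫ iU)
  have hT : (p : Γ(T.left, ⊤)) = 0 := natCast_of_hom T.hom hS
  let F := CommRingCat.ofHom (ringFrob p (n - m) B hB)
  have hF : absFrob p (n - m) T.left hT = Spec.map F := absFrob_Spec p _ (.of B) hT hB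
  have htrivial : CommRingCat.ofHom φ ≫ F =
      CommRingCat.ofHom (Bialgebra.counitAlgHom R A).toRingHom ≫
        CommRingCat.ofHom (algebraMap R A) ≫ CommRingCat.ofHom φ ≫ F := by
    ext a
    refine (sub_eq_zero.1 ?_ : (F.hom.comp φ) a =
      (F.hom.comp φ) (algebraMap R A (Coalgebra.counit a)))
    rw [← map_sub]
    exact hφn _ (by simp [RingHom.mem_ker])
  refine twist_hom_ext p hS n ?_
  calc (H.twistPoint hS hB hφ ≫ relFrobTwist p hS hmn G).left ≫ twistProj p hS n G
      = Spec.map F ≫ Spec.map (CommRingCat.ofHom φ) ≫ iV := by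
        rw [Over.comp_left, Category.assoc, relFrobTwist_proj, ← Category.assoc,
          ← absFrob_naturality p (n - m) _ hT, Category.assoc, H.twistPoint_proj, hF]
    _ = Spec.map F ≫ ((Spec.map (CommRingCat.ofHom φ) ≫ iV) ≫ G.hom) ≫ η[G].left := by
        rw [← Spec.map_comp_assoc, htrivial]
        simp only [Category.assoc, reassoc_of% H.isPullback.w, Spec.map_comp, H.unit]
    _ = absFrob p (n - m) T.left hT ≫ absFrob p m T.left hT ≫ T.hom ≫ η[G].left := by
        rw [H.comp_hom_eq_comp_absFrob hS hB hφ, hF, ← Category.assoc (absFrob p m T.left hT),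
          absFrob_naturality p m T.hom hT hS]
        rfl
    _ = _ := by
        rw [trivial_twist_proj, ← Category.assoc, absFrob_comp]
        congr! 2
        exact Nat.sub_add_cancel hmn

end TwistPoint

section Exactness

variable {p : ℕ} [Fact p.Prime] {S : Scheme.{u}} {hS : (p : Γ(S, ⊤)) = 0} {G : Over S} [GrpObj G]
  {R A B : Type u} [CommRing R] [CommRing A] [CommRing B] [Bialgebra R A]
  {iU : Spec (.of R) ⟶ S} {iV : Spec (.of A) ⟶ G.left} {m n : ℕ}

lemma IsGroupChart.exists_pow_eq_of_comp_relFrob_eq (H : IsGroupChart G iU iV) {hB : (p : B) = 0}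
    {θ : R →+* B} {φ : A →+* B} (hφ : φ.comp (algebraMap R A) = (ringFrob p m B hB).comp θ)
    {D : CommRingCat.{u}} (g : CommRingCat.of B ⟶ D)
    (y : Over.mk (Spec.map g ≫ Spec.map (CommRingCat.ofHom θ) ≫ iU) ⟶ G)
    (hy : y ≫ relFrob p hS m G = Over.homMk (Spec.map g) ≫ H.twistPoint hS hB hφ) :
    ∃ ψ : A →+* D, ∀ a, ψ a ^ p ^ m = g.hom (φ a) := by
  have hDS : (p : Γ(Spec D, ⊤)) = 0 := natCast_of_hom (y.left ≫ G.hom) hS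
  have hD : (p : D) = 0 := natCast_eq_zero_of_Spec p hS (y.left ≫ G.hom)
  let F := CommRingCat.ofHom (ringFrob p m D hD)
  have hF : absFrob p m (Spec D) hDS = Spec.map F := absFrob_Spec p m D hDS hD
  let w : Spec D ⟶ Spec (.of A) :=
    H.isPullback.lift y.left (Spec.map g ≫ Spec.map (CommRingCat.ofHom θ))
      ((Over.w y).trans (Category.assoc _ _ _).symm)
  let ψ : CommRingCat.of A ⟶ D := Spec.preimage w
  have hψ : Spec.map ψ = w := Spec.map_preimage w
  have hθF : CommRingCat.ofHom θ ≫ g ≫ F =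
      CommRingCat.ofHom (algebraMap R A) ≫ CommRingCat.ofHom φ ≫ g := by
    ext r
    exact (map_pow g.hom (θ r) (p ^ m)).symm.trans (congrArg (fun f => g.hom (f r)) hφ.symm)
  have hpow : ψ ≫ F = CommRingCat.ofHom φ ≫ g := by
    refine Spec.map_injective (H.isPullback.hom_ext ?_ ?_)
    · calc Spec.map (ψ ≫ F) ≫ iV = Spec.map F ≫ y.left := by
            rw [Spec.map_comp, Category.assoc, hψ, H.isPullback.lift_fst]
        _ = (y ≫ relFrob p hS m G).left ≫ twistProj p hS m G := by
            rw [Over.comp_left, Category.assoc, relFrob_proj, ← hF]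
            exact absFrob_naturality p m y.left hDS _
        _ = Spec.map (CommRingCat.ofHom φ ≫ g) ≫ iV := by
            rw [hy, Over.comp_left, Category.assoc, H.twistPoint_proj, Spec.map_comp,
              Category.assoc]
            rfl
    · rw [Spec.map_comp, Category.assoc, hψ, H.isPullback.lift_snd, ← Spec.map_comp,
        ← Spec.map_comp, ← Spec.map_comp, Category.assoc, hθF]
  exact ⟨ψ.hom, fun a => congrArg (fun f => f.hom a) hpow⟩

lemma IsGroupChart.exists_mem_fpqcTopology_exists_pow_eq (H : IsGroupChart G iU iV)
    {hmn : m ≤ n} (hexact : FpqcExact (relFrob p hS m G) (relFrobTwist p hS hmn G))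
    (hB : (p : B) = 0) {θ : R →+* B} {φ : A →+* B}
    (hφ : φ.comp (algebraMap R A) = (ringFrob p m B hB).comp θ)
    (hφn : ∀ a ∈ augmentationIdeal R A, φ a ^ p ^ (n - m) = 0) :
    ∃ W ∈ Scheme.fpqcTopology (Spec (.of B)), ∀ (D : CommRingCat.{u}) (g : .of B ⟶ D),
      W (Spec.map g) → ∃ ψ : A →+* D, ∀ a, ψ a ^ p ^ m = g.hom (φ a) := by
  obtain ⟨W, hW, hlift⟩ := hexact.locally_lifts _ (H.twistPoint hS hB hφ)
    (H.twistPoint_relFrobTwist hS hB hφ hmn hφn)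
  refine ⟨Sieve.overEquiv _ W, hW, fun D g hg => ?_⟩
  rw [Sieve.overEquiv_iff] at hg
  obtain ⟨y, hy⟩ := hlift _ hg
  exact H.exists_pow_eq_of_comp_relFrob_eq hφ g y hy

/-- The test point is `H → H/I^[p^l]`, which is a point of the twist because `k` is perfect. -/
lemma IsGroupChart.frobeniusReflects {k H : Type u} [Field k] [CharP k p] [PerfectRing k p]
    [CommRing H] [Bialgebra k H] {iU : Spec (.of k) ⟶ S} {iV : Spec (.of H) ⟶ G.left}
    (hH : IsGroupChart G iU iV) {hmn : m ≤ n}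
    (hexact : FpqcExact (relFrob p hS m G) (relFrobTwist p hS hmn G)) :
    FrobeniusReflects k H p m n := by
  intro l hl b hb
  set J := bracketPower (augmentationIdeal k H) (p ^ l)
  have hB : (p : H ⧸ J) = 0 := by
    rw [← map_natCast (algebraMap k (H ⧸ J)), CharP.cast_eq_zero, map_zero]
  have hφ : (Ideal.Quotient.mk J).comp (algebraMap k H) = (ringFrob p m (H ⧸ J) hB).comp
      ((algebraMap k (H ⧸ J)).comp (iterateFrobeniusEquiv k p m).symm.toRingHom) := by
    ext c
    refine Eq.trans ?_ (map_pow (algebraMap k (H ⧸ J)) _ (p ^ m))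
    exact congrArg (algebraMap k (H ⧸ J)) ((iterateFrobeniusEquiv k p m).apply_symm_apply c).symm
  obtain ⟨W, hW, hlift⟩ := hH.exists_mem_fpqcTopology_exists_pow_eq hexact hB hφ fun a ha => by
    refine pow_eq_zero_of_le (Nat.pow_le_pow_right (Fact.out : p.Prime).pos
      (Nat.le_sub_of_add_le' hl)) ?_
    exact Ideal.Quotient.eq_zero_iff_mem.2 (pow_mem_bracketPower ha (p ^ l))
  refine Ideal.Quotient.eq_zero_iff_mem.1 (eq_zero_of_mem_fpqcTopology hW fun D g hg => ?_)
  obtain ⟨ψ, hψ⟩ := hlift D g hg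
  have hker : bracketPower (augmentationIdeal k H) (p ^ (m + l)) ≤ RingHom.ker ψ := by
    refine bracketPower_le_iff.2 fun a ha => ?_
    rw [RingHom.mem_ker, map_pow, pow_add, pow_mul, hψ, ← map_pow, ← map_pow,
      Ideal.Quotient.eq_zero_iff_mem.2 (pow_mem_bracketPower ha _), map_zero]
  rw [← hψ, ← map_pow]
  exact hker hb

end Exactness

section Truncated

open scoped TensorProduct

lemma bijective_of_forall_apply_eq_basis {R M N J : Type*} [CommRing R] [AddCommGroup M]
    [Module R M] [AddCommGroup N] [Module R N] {f : M →ₗ[R] N} {v : J → M}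
    (hv : Submodule.span R (Set.range v) = ⊤) (b : Module.Basis J R N) (h : ∀ i, f (v i) = b i) :
    Function.Bijective f := by
  have hsurj : Function.Surjective (Finsupp.linearCombination R v) := by
    rwa [← LinearMap.range_eq_top, Finsupp.range_linearCombination]
  have hcomp : f ∘ₗ Finsupp.linearCombination R v = b.repr.symm.toLinearMap := by
    ext i
    simp [h]
  have hbij : Function.Bijective (f ∘ Finsupp.linearCombination R v) := by
    rw [← LinearMap.coe_comp, hcomp]
    exact b.repr.symm.bijective
  exact ⟨hbij.injective.of_comp_right hsurj, hbij.surjective.of_comp⟩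

variable {p n r : ℕ}

/-- The class of the variable `x_i` in `A_{n,r}`. -/
def truncVar (i : Fin r) : TruncPoly.{u} p n r := Ideal.Quotient.mk _ (MvPolynomial.X i)

lemma truncVar_pow (i : Fin r) : (truncVar i : TruncPoly.{u} p n r) ^ p ^ n = 0 :=
  Ideal.Quotient.eq_zero_iff_mem.2 (Ideal.subset_span ⟨i, rfl⟩)

lemma adjoin_range_truncVar :
    Algebra.adjoin (Fp.{u} p) (Set.range (truncVar : Fin r → TruncPoly.{u} p n r)) = ⊤ := by
  have h := congrArg (Subalgebra.map (Ideal.Quotient.mkₐ (Fp.{u} p) (truncIdeal p n r)))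
    (MvPolynomial.adjoin_range_X (R := Fp.{u} p) (σ := Fin r))
  rwa [AlgHom.map_adjoin, ← Set.range_comp, Algebra.map_top,
    (AlgHom.range_eq_top _).2 (Ideal.Quotient.mkₐ_surjective _ _)] at h

variable (p n r) in
lemma span_truncMonomial_truncVar :
    Submodule.span (Fp.{u} p) (Set.range
      (truncMonomial (N := p ^ n) (truncVar : Fin r → TruncPoly.{u} p n r))) = ⊤ :=
  span_truncMonomial_eq_top adjoin_range_truncVar truncVar_pow

lemma truncPoly_ringHom_ext {C : Type*} [CommRing C] {f g : TruncPoly.{u} p n r →+* C}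
    (hc : ∀ c : Fp.{u} p, f (algebraMap _ _ c) = g (algebraMap _ _ c))
    (hX : ∀ i, f (truncVar i) = g (truncVar i)) : f = g :=
  Ideal.Quotient.ringHom_ext (MvPolynomial.ringHom_ext hc hX)

lemma truncAug_algebraMap [Fact p.Prime] (c : Fp.{u} p) :
    truncAug p n r (algebraMap _ _ c) = c :=
  MvPolynomial.aeval_C _ c

lemma truncAug_truncVar [Fact p.Prime] (i : Fin r) : truncAug.{u} p n r (truncVar i) = 0 :=
  MvPolynomial.aeval_X _ i

variable {A : Type u} [CommRing A] [Algebra (Fp.{u} p) A]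

/-- The homomorphism `A_{n,r} →ₐ A`, `x_i ↦ x i`, given by elements with `x i ^ p ^ n = 0`. -/
def truncLift (x : Fin r → A) (hx : ∀ i, x i ^ p ^ n = 0) : TruncPoly.{u} p n r →ₐ[Fp.{u} p] A :=
  Ideal.Quotient.liftₐ (truncIdeal p n r) (MvPolynomial.aeval x) fun a ha => by
    have hle : truncIdeal p n r ≤ RingHom.ker (MvPolynomial.aeval (R := Fp.{u} p) x) := by
      rw [truncIdeal, Ideal.span_le]
      rintro _ ⟨i, rfl⟩
      simp [RingHom.mem_ker, hx]
    exact hle ha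

lemma truncLift_truncVar (x : Fin r → A) (hx : ∀ i, x i ^ p ^ n = 0) (i : Fin r) :
    truncLift x hx (truncVar i) = x i :=
  MvPolynomial.aeval_X x i

lemma isPushout_truncLift {R : Type u} [CommRing R] [Algebra (Fp.{u} p) R] [Algebra R A]
    [IsScalarTower (Fp.{u} p) R A] (x : Fin r → A) (hx : ∀ i, x i ^ p ^ n = 0)
    (b : Module.Basis (Fin r → Fin (p ^ n)) R A) (hb : ∀ α, b α = truncMonomial x α) :
    IsPushout (CommRingCat.ofHom (algebraMap (Fp.{u} p) R))
      (CommRingCat.ofHom (algebraMap (Fp.{u} p) (TruncPoly.{u} p n r)))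
      (CommRingCat.ofHom (algebraMap R A))
      (CommRingCat.ofHom (R := TruncPoly.{u} p n r) (truncLift x hx).toRingHom) := by
  let Ψ : R ⊗[Fp.{u} p] TruncPoly.{u} p n r →ₐ[R] A :=
    Algebra.TensorProduct.lift (Algebra.ofId R A) (truncLift x hx) fun _ _ => .all _ _
  have hspan : Submodule.span R (Set.range fun α : Fin r → Fin (p ^ n) =>
      (1 : R) ⊗ₜ[Fp.{u} p] truncMonomial (truncVar : _ → TruncPoly.{u} p n r) α) = ⊤ := by
    have h := congrArg (Submodule.baseChange R) (span_truncMonomial_truncVar.{u} p n r)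
    rwa [Submodule.baseChange_span, Submodule.baseChange_top, ← Set.range_comp] at h
  have hΨ : Function.Bijective Ψ :=
    bijective_of_forall_apply_eq_basis (f := Ψ.toLinearMap) hspan b fun α => by
      simp only [Ψ, AlgHom.toLinearMap_apply, Algebra.TensorProduct.lift_tmul, map_one,
        _root_.one_mul, map_truncMonomial, hb]
      exact congrArg (truncMonomial · α) (funext (truncLift_truncVar x hx))
  refine (CommRingCat.isPushout_tensorProduct (Fp.{u} p) R (TruncPoly.{u} p n r)).of_iso
    (.refl _) (.refl _) (.refl _) (RingEquiv.ofBijective Ψ.toRingHom hΨ).toCommRingCatIso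
    ?_ ?_ ?_ ?_
  · simp
  · simp
  · ext c
    simp [Ψ]
  · refine CommRingCat.hom_ext (RingHom.ext fun t => ?_)
    change Ψ (1 ⊗ₜ t) = truncLift x hx t
    simp [Ψ]

end Truncated

section TruncatedChart

variable {p : ℕ} [Fact p.Prime] {S : Scheme.{u}} {π : S ⟶ Spec (.of (Fp.{u} p))} {G : Over S}
  [GrpObj G] {n r : ℕ}

lemma exists_iso_truncOver_of_isPullback {U V : Scheme.{u}} {f : U ⟶ S} {q : V ⟶ U}
    {g : V ⟶ G.left} {t : V ⟶ Spec (.of (TruncPoly.{u} p n r))} (hG : IsPullback g q G.hom f)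
    (ht : IsPullback q t (f ≫ π) (truncStr p n r)) {s : U ⟶ V} (hsq : s ≫ q = 𝟙 U)
    (hsg : s ≫ g = f ≫ η[G].left) (hst : s ≫ t = (f ≫ π) ≫ truncPoint p n r) :
    ∃ e : (Over.pullback f).obj G ≅ truncOver p n r (f ≫ π),
      η[(Over.pullback f).obj G] ≫ e.hom = truncSection p n r (f ≫ π) := by
  let i := hG.isoPullback.symm
  let j := ht.isoPullback
  let e : (Over.pullback f).obj G ≅ truncOver p n r (f ≫ π) := Over.isoMk (i ≪≫ j) <| by
    change (i.hom ≫ j.hom) ≫ pullback.fst _ _ = pullback.snd _ _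
    rw [Category.assoc, ht.isoPullback_hom_fst, Iso.symm_hom, hG.isoPullback_inv_snd]
  have hη : η[(Over.pullback f).obj G].left ≫ i.hom = s := by
    refine hG.hom_ext ?_ ?_
    · rw [Category.assoc, Iso.symm_hom, hG.isoPullback_inv_fst, hsg]
      exact unit_pullback_fst f G
    · rw [Category.assoc, Iso.symm_hom, hG.isoPullback_inv_snd, hsq]
      exact Over.w η[(Over.pullback f).obj G]
  refine ⟨e, Over.OverMorphism.ext (pullback.hom_ext ?_ ?_)⟩
  · exact (Over.w (η[(Over.pullback f).obj G] ≫ e.hom)).trans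
      (Over.w (truncSection p n r (f ≫ π))).symm
  · calc (η[(Over.pullback f).obj G].left ≫ i.hom ≫ j.hom) ≫ pullback.snd _ _ = s ≫ t := by
          rw [reassoc_of% hη, Category.assoc, ht.isoPullback_hom_snd]
      _ = (f ≫ π) ≫ truncPoint p n r := hst
      _ = (truncSection p n r (f ≫ π)).left ≫ pullback.snd _ _ := (pullback.lift_snd _ _ _).symm

lemma toRingHom_comp_truncLift {R A : Type u} [CommRing R] [CommRing A] [Algebra (Fp.{u} p) R]
    [Algebra (Fp.{u} p) A] [Algebra R A] [IsScalarTower (Fp.{u} p) R A] (e : A →ₐ[R] R)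
    {x : Fin r → A} (hx : ∀ i, x i ^ p ^ n = 0) (he : ∀ i, e (x i) = 0) :
    e.toRingHom.comp (truncLift x hx).toRingHom =
      (algebraMap (Fp.{u} p) R).comp (truncAug p n r) := by
  refine truncPoly_ringHom_ext (fun c => ?_) fun i => ?_
  · rw [RingHom.comp_apply, RingHom.comp_apply, truncAug_algebraMap]
    change e (truncLift x hx (algebraMap _ _ c)) = _
    rw [AlgHom.commutes, IsScalarTower.algebraMap_apply (Fp.{u} p) R A, e.commutes]
    rfl
  · rw [RingHom.comp_apply, RingHom.comp_apply, truncAug_truncVar, map_zero]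
    exact (congrArg e (truncLift_truncVar x hx i)).trans (he i)

lemma exists_isPullback_truncStr {R A : Type u} [CommRing R] [CommRing A] [Bialgebra R A]
    (π : Spec (.of R) ⟶ Spec (.of (Fp.{u} p))) {x : Fin r → A} (hx : ∀ i, x i ^ p ^ n = 0)
    (hxI : ∀ i, x i ∈ augmentationIdeal R A) (b : Module.Basis (Fin r → Fin (p ^ n)) R A)
    (hb : ∀ α, b α = truncMonomial x α) :
    ∃ t : Spec (.of A) ⟶ Spec (.of (TruncPoly.{u} p n r)),
      IsPullback (Spec.map (CommRingCat.ofHom (algebraMap R A))) t π (truncStr p n r) ∧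
      Spec.map (CommRingCat.ofHom (Bialgebra.counitAlgHom R A).toRingHom) ≫ t =
        π ≫ truncPoint p n r := by
  obtain ⟨ρ, rfl⟩ := Spec.map_surjective π
  let _ : Algebra (Fp.{u} p) R := ρ.hom.toAlgebra
  let _ : Algebra (Fp.{u} p) A := ((algebraMap R A).comp ρ.hom).toAlgebra
  have : IsScalarTower (Fp.{u} p) R A := .of_algebraMap_eq fun _ => rfl
  refine ⟨_, isPullback_SpecMap_of_isPushout _ _ _ _ (isPushout_truncLift x hx b hb), ?_⟩
  rw [truncPoint, ← Spec.map_comp, ← Spec.map_comp, ← CommRingCat.ofHom_comp,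
    toRingHom_comp_truncLift _ hx hxI]
  rfl

lemma IsGroupChart.exists_iso_truncOver {U : S.Opens} {hU : IsAffineOpen U} {A : Type u}
    [CommRing A] [Bialgebra Γ(S, U) A] {iV : Spec (.of A) ⟶ G.left}
    (H : IsGroupChart G hU.fromSpec iV) {x : Fin r → A} (hx : ∀ i, x i ^ p ^ n = 0)
    (hxI : ∀ i, x i ∈ augmentationIdeal Γ(S, U) A)
    (b : Module.Basis (Fin r → Fin (p ^ n)) Γ(S, U) A) (hb : ∀ α, b α = truncMonomial x α) :
    ∃ e : (Over.pullback U.ι).obj G ≅ truncOver p n r (U.ι ≫ π),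
      η[(Over.pullback U.ι).obj G] ≫ e.hom = truncSection p n r (U.ι ≫ π) := by
  obtain ⟨t, ht, hεt⟩ := exists_isPullback_truncStr (hU.fromSpec ≫ π) hx hxI b hb
  let c := hU.isoSpec
  have hc : c.inv ≫ U.ι = hU.fromSpec := hU.isoSpec_inv_ι
  have hc' : c.hom ≫ hU.fromSpec = U.ι := by rw [← hc, Iso.hom_inv_id_assoc]
  let ε := Bialgebra.counitAlgHom Γ(S, U) A
  have hε : CommRingCat.ofHom (algebraMap Γ(S, U) A) ≫ CommRingCat.ofHom ε.toRingHom = 𝟙 _ := by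
    ext a
    exact ε.commutes a
  refine exists_iso_truncOver_of_isPullback (g := iV) (t := t)
    (q := Spec.map (CommRingCat.ofHom (algebraMap Γ(S, U) A)) ≫ c.inv)
    (s := c.hom ≫ Spec.map (CommRingCat.ofHom ε.toRingHom))
    (H.isPullback.of_iso (.refl _) (.refl _) c.symm (.refl _)
      (by simp) (by simp) (by simp) (by simp [hc]))
    (ht.of_iso (.refl _) c.symm (.refl _) (.refl _)
      (by simp) (by simp) (by simp [reassoc_of% hc]) (by simp)) ?_ ?_ ?_
  · rw [Category.assoc, ← Spec.map_comp_assoc, hε, Spec.map_id]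
    exact (congrArg (c.hom ≫ ·) (Category.id_comp c.inv)).trans c.hom_inv_id
  · rw [Category.assoc, H.unit, reassoc_of% hc']
  · rw [Category.assoc, hεt, Category.assoc, reassoc_of% hc', Category.assoc]

lemma mem_basicOpen_of_notMem_primeIdealOf {X : Scheme.{u}} {U : X.Opens} (hU : IsAffineOpen U)
    {x : X} (hx : x ∈ U) {f : Γ(X, U)} (hf : f ∉ (hU.primeIdealOf ⟨x, hx⟩).asIdeal) :
    x ∈ X.basicOpen f := by
  have h : hU.primeIdealOf ⟨x, hx⟩ ∈ hU.fromSpec ⁻¹ᵁ X.basicOpen f := by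
    rwa [hU.fromSpec_preimage_basicOpen]
  have hmem : hU.fromSpec (hU.primeIdealOf ⟨x, hx⟩) ∈ X.basicOpen f := h
  rwa [hU.fromSpec_primeIdealOf] at hmem

end TruncatedChart

section BaseChange

open scoped TensorProduct

variable {R R' A : Type*} [CommRing R] [CommRing R'] [Algebra R R'] [CommRing A] [Bialgebra R A]

lemma counitAlgHom_one_tmul (a : A) :
    Bialgebra.counitAlgHom R' (R' ⊗[R] A) (1 ⊗ₜ a) =
      algebraMap R R' (Bialgebra.counitAlgHom R A a) := by
  simp [Algebra.algebraMap_eq_smul_one]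

variable (R R' A) in
lemma augmentationIdeal_baseChange :
    augmentationIdeal R' (R' ⊗[R] A) =
      Ideal.span ((fun a : A => (1 : R') ⊗ₜ[R] a) '' augmentationIdeal R A) := by
  refine le_antisymm (fun z hz => ?_) (Ideal.span_le.2 ?_)
  · suffices hsub : ∀ z : R' ⊗[R] A,
        z - algebraMap R' _ (Bialgebra.counitAlgHom R' (R' ⊗[R] A) z) ∈
          Ideal.span ((fun a : A => (1 : R') ⊗ₜ[R] a) '' augmentationIdeal R A) by
      simpa [RingHom.mem_ker.1 hz] using hsub z
    intro z
    induction z with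
    | zero => simp
    | add y z hy hz =>
      rw [map_add, map_add, add_sub_add_comm]
      exact add_mem hy hz
    | tmul c a =>
      let ε := Bialgebra.counitAlgHom R A
      have ha : a - algebraMap R A (ε a) ∈ augmentationIdeal R A := by
        rw [RingHom.mem_ker, map_sub, sub_eq_zero]
        exact (ε.commutes _).symm
      have hmul : c ⊗ₜ[R] a - algebraMap R' _ (Bialgebra.counitAlgHom R' (R' ⊗[R] A) (c ⊗ₜ a)) =
          c ⊗ₜ 1 * (1 : R') ⊗ₜ[R] (a - algebraMap R A (ε a)) := by
        simp [ε, TensorProduct.tmul_sub, mul_sub, Algebra.algebraMap_eq_smul_one,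
          Algebra.TensorProduct.one_def, TensorProduct.smul_tmul']
      rw [hmul]
      exact Ideal.mul_mem_left _ _ (Ideal.subset_span ⟨_, ha, rfl⟩)
  · rintro _ ⟨a, ha, rfl⟩
    rw [SetLike.mem_coe, RingHom.mem_ker, counitAlgHom_one_tmul, RingHom.mem_ker.1 ha, map_zero]

lemma truncMonomial_one_tmul {σ : Type*} [Fintype σ] {q : ℕ} (x : σ → A) (α : σ → Fin q) :
    truncMonomial (fun i => (1 : R') ⊗ₜ[R] x i) α = 1 ⊗ₜ truncMonomial x α :=
  (map_truncMonomial (Algebra.TensorProduct.includeRight : A →ₐ[R] R' ⊗[R] A) x α).symm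

end BaseChange

section SpreadingOut

open scoped TensorProduct

variable {p : ℕ} [Fact p.Prime] {S : Scheme.{u}} {hS : (p : Γ(S, ⊤)) = 0} {G : Over S} [GrpObj G]
  {m n : ℕ}

lemma IsGroupChart.exists_basis_truncMonomial_fiber {R A K : Type u} [CommRing R] [CommRing A]
    [Bialgebra R A] [Module.Finite R A] [Field K] [PerfectField K] [Algebra R K]
    {iU : Spec (.of R) ⟶ S} {iV : Spec (.of A) ⟶ G.left} (H : IsGroupChart G iU iV)
    (hkilled : KilledByFrob p hS n G) (hm : 1 ≤ m) (hmn : m < n)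
    (hexact : FpqcExact (relFrob p hS m G) (relFrobTwist p hS hmn.le G)) :
    ∃ (r : ℕ) (x : Fin r → A) (_ : ∀ i, x i ∈ augmentationIdeal R A)
      (b : Module.Basis (Fin r → Fin (p ^ n)) K (K ⊗[R] A)), ∀ α, b α = 1 ⊗ₜ truncMonomial x α := by
  have HK := H.baseChange K
  have : CharP K p := (CharP.charP_iff_prime_eq_zero Fact.out).2 <|
    natCast_eq_zero_of_Spec p hS (R := .of K) (Spec.map (CommRingCat.ofHom (algebraMap R K)) ≫ iU)
  have hkill : ∀ a ∈ augmentationIdeal K (K ⊗[R] A), a ^ p ^ n = 0 := fun a ha =>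
    HK.pow_eq_zero_of_killedByFrob hkilled ha
  have := PerfectField.toPerfectRing (K := K) p
  obtain ⟨r, y, hy, hspan, hli⟩ := exists_coordinates (fun a ha => ⟨_, hkill a ha⟩)
    (augmentationIdeal_baseChange R K A).symm
  choose x hx hxy using hy
  obtain rfl : (fun i => 1 ⊗ₜ x i) = y := funext hxy
  obtain ⟨b, hb⟩ := (HK.frobeniusReflects hexact).exists_basis_truncMonomial hm hmn hkill
    hspan hli
  exact ⟨r, x, hx, b, fun α => (hb α).trans (truncMonomial_one_tmul x α)⟩

lemma IsGroupChart.exists_iso_truncOver_basicOpen {π : S ⟶ Spec (.of (Fp.{u} p))} {r : ℕ}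
    {U : S.Opens} {hU : IsAffineOpen U} {A : Type u} [CommRing A] [Bialgebra Γ(S, U) A]
    {iV : Spec (.of A) ⟶ G.left} (H : IsGroupChart G hU.fromSpec iV) {x : Fin r → A}
    (hx : ∀ i, x i ^ p ^ n = 0)
    (hxI : ∀ i, x i ∈ augmentationIdeal Γ(S, U) A) (f : Γ(S, U))
    (b : Module.Basis (Fin r → Fin (p ^ n)) Γ(S, S.basicOpen f)
      (Γ(S, S.basicOpen f) ⊗[Γ(S, U)] A))
    (hb : ∀ α, b α = 1 ⊗ₜ truncMonomial x α) :
    ∃ e : (Over.pullback (S.basicOpen f).ι).obj G ≅ truncOver p n r ((S.basicOpen f).ι ≫ π),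
      η[(Over.pullback (S.basicOpen f).ι).obj G] ≫ e.hom =
        truncSection p n r ((S.basicOpen f).ι ≫ π) := by
  have hf := hU.basicOpen f
  have hres : Spec.map (CommRingCat.ofHom (algebraMap Γ(S, U) Γ(S, S.basicOpen f))) ≫
      hU.fromSpec = hf.fromSpec := hU.map_fromSpec hf _
  have Hf := H.baseChange Γ(S, S.basicOpen f)
  rw [hres] at Hf
  refine Hf.exists_iso_truncOver (x := fun i => 1 ⊗ₜ x i) (fun i => ?_) (fun i => ?_) b
    fun α => (hb α).trans (truncMonomial_one_tmul x α).symm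
  · rw [Algebra.TensorProduct.tmul_pow, hx, TensorProduct.tmul_zero]
  · rw [RingHom.mem_ker, counitAlgHom_one_tmul, RingHom.mem_ker.1 (hxI i), map_zero]

end SpreadingOut

end

end NSmooth

theorem propositionp (p : ℕ) [Fact p.Prime] (S : Scheme.{u})
    (π : S ⟶ Spec (.of (NSmooth.Fp.{u} p)))
    (G : Over S) [GrpObj G] [IsFinite G.hom] [Flat G.hom] [LocallyOfFinitePresentation G.hom]
    (n : ℕ) (hkilled : NSmooth.KilledByFrob p (NSmooth.natCast_of_Fp π) n G)
    (hexact : ∃ (m : ℕ) (_ : 1 ≤ m) (hmn : m < n),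
      NSmooth.FpqcExact
        (NSmooth.relFrob p (NSmooth.natCast_of_Fp π) m G)
        (NSmooth.relFrobTwist p (NSmooth.natCast_of_Fp π) hmn.le G)) :
    NSmooth.IsNSmooth p π n G := by
  obtain ⟨m, hm, hmn, hexact⟩ := hexact
  intro s
  obtain ⟨U, hU, hsU, -⟩ := exists_isAffineOpen_mem_and_subset (Opens.mem_top s)
  obtain ⟨A, _, _, iV, H⟩ := NSmooth.exists_isGroupChart G hU.fromSpec
  have := H.module_flat
  have := H.module_finitePresentation
  let P := (hU.primeIdealOf ⟨s, hsU⟩).asIdeal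
  obtain ⟨r, x, hxI, hx⟩ := H.exists_basis_truncMonomial_fiber
    (K := AlgebraicClosure P.ResidueField) hkilled hm hmn hexact
  obtain ⟨f, hf, hbasis⟩ := NSmooth.exists_notMem_forall_basis_baseChange P hx
  have := hU.isLocalization_basicOpen f
  obtain ⟨b, hb⟩ := hbasis Γ(S, S.basicOpen f)
  obtain ⟨e, he⟩ := H.exists_iso_truncOver_basicOpen
    (fun i => H.pow_eq_zero_of_killedByFrob hkilled (hxI i)) hxI f b hb
  exact ⟨S.basicOpen f, NSmooth.mem_basicOpen_of_notMem_primeIdealOf hU hsU hf, r, e, he⟩
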